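/- Let $\Gamma$ be a finite connected graph without loops or multiple edges in which every vertex has degree at least $2$; write $1+q(x)$ for the degree of a vertex $x$. Let $V$ be its vertex set and $E$ its set of oriented edges, with initial and terminal vertices $\iota(e),\tau(e)$ and opposite edge $\bar e$. Write $e\to e'$ (a \emph{turn}) if $\tau(e)=\iota(e')$ and $e\neq\overline{e'}$. Let $\mathcal P$ be the compact space of infinite sequences $e_1\to e_2\to\cdots$, with the sets $\mathcal P_{c}$ of paths with a given finite initial segment $c$ as basic open sets. For a compact totally disconnected space $X$ let $\mathcal M(X)$ be the space of complex-valued finitely additive measures on its clopen subsets. \emph{On the graph.} For $z\in\mathbb C\setminus\{0\}$ put $(\Sigma\varphi)(x)=\sum_{y\sim x}\varphi(y)$, $(N_z\varphi)(x)=(z+z^{-1}q(x))\varphi(x)$ and $(\nabla_z\varphi)(e)=\varphi(\iota(e))-z^{-1}\varphi(\tau(e))$ for $\varphi:V\to\mathbb C$, and $(Sf)(e)=\sum_{e'\to e}f(e')$, $(\mathcal I f)(x)=\sum_{\tau(e)=x}f(e)$ for $f:E\to\mathbb C$. Let $\mathcal L$ be the transfer operator $(\mathcal L F)(e_1\to e_2\to\cdots)=\sum_{e_0\to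 e_1}F(e_0\to e_1\to\cdots)$ on locally constant functions on $\mathcal P$, and $\mathcal L'$ the dual operator on $\mathcal M(\mathcal P)$, so $(\mathcal L'\mu)(A)=\int\mathcal L\mathbf 1_A\,d\mu$. For operators $A,B$ let $\mathrm{Eq}(A,B)=\{v: Av=Bv\}$. \emph{On the universal cover.} Fix a vertex $o$ of $\Gamma$. Let $T$ be the universal cover of $\Gamma$: its vertices are the finite (possibly empty) edge paths without backtracking starting at $o$, two of them being adjacent if one extends the other by one edge; let $p:T\to\Gamma$ be the end point map, $\tilde o$ the empty path, and let $\pi_1$ be the group of deck transformations, i.e. of automorphisms $\gamma$ of $T$ with $p\circ\gamma=p$. Let $\widetilde\Sigma,\widetilde N_z$ be the operators $\Sigma,N_z$ for $T$. The boundary $\partial T$ is the set of rays (infinite edge paths without backtracking) in $T$ modulo eventual coincidence up to a shift, with the topology generated by the sets of ends of rays starting with a given oriented edge. For $\omega\in\partial T$ and vertices $x,y$ let $\langle x,y\rangle_\omega=d(x,w)-d(y,w)$ for any vertex $w$ lying on both rays from $x$ and from $y$ to $\omega$. The Poisson transform of $\mu\in\mathcal M(\partial T)$ is $(P_z\mu)(x)=\int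 z^{\langle\tilde o,x\rangle_\omega}\,d\mu(\omega)$. The twisted action of $\gamma\in\pi_1$ on $\mathcal M(\partial T)$ is $\mu\mapsto z^{\langle\gamma\tilde o,\tilde o\rangle_{\omega}}\cdot\gamma_*\mu$; let $\mathcal M(\partial T)^{\pi_1,z}$ be the space of measures fixed by it for all $\gamma\in\pi_1$, and let the superscript $\pi_1$ on spaces of functions on the vertices of $T$ denote the subspace of $\pi_1$-invariant functions. Lifting paths identifies the clopen set of paths in $\mathcal P$ starting at $o$ with $\partial T$; let $R:\mathcal M(\mathcal P)\to\mathcal M(\partial T)$ be restriction to this set, followed by this identification. \emph{Theorem.} Let $z\notin\{-1,0,1\}$. Then the following are linear isomorphisms: \begin{enumerate} \item $\Phi:\mathrm{Eq}(\mathcal L',z\,\mathrm{id})\to\mathrm{Eq}(S,z\,\mathrm{id})$, $(\Phi\mu)(e)=\mu(\mathcal P_{\bar e})$, whose inverse satisfies $(\Phi^{-1}f)(\mathcal P_{e_1\to\cdots\to e_n})=z^{1-n}f(\overline{e_n})$; \item $\mathcal I:\mathrm{Eq}(S,z\,\mathrm{id})\to\mathrm{Eq}(\Sigma,N_z)$,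 with inverse $(z-z^{-1})^{-1}\nabla_z$; \item $\mathrm{lift}:\mathrm{Eq}(\Sigma,N_z)\to\mathrm{Eq}(\widetilde\Sigma,\widetilde N_z)^{\pi_1}$, $\varphi\mapsto\varphi\circ p$; \item $R:\mathrm{Eq}(\mathcal L',z\,\mathrm{id})\to\mathcal M(\partial T)^{\pi_1,z}$; \item $P_z:\mathcal M(\partial T)^{\pi_1,z}\to\mathrm{Eq}(\widetilde\Sigma,\widetilde N_z)^{\pi_1}$; \end{enumerate} and the diagram commutes: $P_z\circ R=\mathrm{lift}\circ\mathcal I\circ\Phi$ on $\mathrm{Eq}(\mathcal L',z\,\mathrm{id})$. Moreover $\mathrm{Eq}(\Sigma,N_z)$ equals the equalizer of the neighbor averaging operator $(1+q)^{-1}\Sigma$ and of multiplication by $(z+z^{-1}q)/(1+q)$, and likewise for $\mathrm{Eq}(\widetilde\Sigma,\widetilde N_z)^{\pi_1}$ on $T$. -/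

import Mathlib

open scoped Topology

noncomputable section

namespace GraphSpectral

/-! ### Graphs, turns and the local operators -/

section Graph

variable {V : Type*} {G : SimpleGraph V}

/-- Two oriented edges form a turn if the first ends where the second starts and they are not
opposite to each other. -/
def Turn (e e' : G.Dart) : Prop := e.snd = e'.fst ∧ e ≠ e'.symm

instance [DecidableEq V] (e e' : G.Dart) : Decidable (Turn e e') := by
  unfold Turn; infer_instance

variable (G)

/-- The neighbor sum operator `Σ`. -/
def neighborSum [G.LocallyFinite] : (V → ℂ) →ₗ[ℂ] (V → ℂ) where
  toFun φ x := ∑ y ∈ G.neighborFinset x, φ y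
  map_add' φ ψ := by ext x; simp [Finset.sum_add_distrib]
  map_smul' c φ := by ext x; simp [Finset.mul_sum]

/-- The twisted rescaling operator: multiplication by `z + q z⁻¹`, where `1 + q` is the degree. -/
def rescale [G.LocallyFinite] (z : ℂ) : (V → ℂ) →ₗ[ℂ] (V → ℂ) where
  toFun φ x := (z + ((G.degree x : ℂ) - 1) * z⁻¹) * φ x
  map_add' φ ψ := by ext x; simp [mul_add]
  map_smul' c φ := by ext x; simp [mul_left_comm]

/-- The Laplacian: averaging over the neighbors. -/
def neighborAvg [G.LocallyFinite] : (V → ℂ) →ₗ[ℂ] (V → ℂ) where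
  toFun φ x := (1 / (G.degree x : ℂ)) * ∑ y ∈ G.neighborFinset x, φ y
  map_add' φ ψ := by ext x; simp [Finset.sum_add_distrib, mul_add]
  map_smul' c φ := by ext x; simp [Finset.mul_sum, mul_left_comm]

/-- The normalized rescaling operator: multiplication by `(z + q z⁻¹) / (1 + q)`. -/
def localTweak [G.LocallyFinite] (z : ℂ) : (V → ℂ) →ₗ[ℂ] (V → ℂ) where
  toFun φ x := ((z + ((G.degree x : ℂ) - 1) * z⁻¹) / (G.degree x : ℂ)) * φ x
  map_add' φ ψ := by ext x; simp [mul_add]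
  map_smul' c φ := by ext x; simp [mul_left_comm]

/-- The twisted gradient. -/
def gradient (z : ℂ) : (V → ℂ) →ₗ[ℂ] (G.Dart → ℂ) where
  toFun φ e := φ e.fst - z⁻¹ * φ e.snd
  map_add' φ ψ := by ext e; simp only [Pi.add_apply]; ring
  map_smul' c φ := by ext e; simp only [Pi.smul_apply, smul_eq_mul, RingHom.id_apply]; ring

variable [Fintype V] [DecidableEq V] [DecidableRel G.Adj]

/-- The turn sum operator `S`. -/
def turnSum : (G.Dart → ℂ) →ₗ[ℂ] (G.Dart → ℂ) where
  toFun f e := ∑ e' : G.Dart with Turn e' e, f e'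
  map_add' f g := by ext e; simp [Finset.sum_add_distrib]
  map_smul' c f := by ext e; simp [Finset.mul_sum]

/-- Summation over incoming edges. -/
def inSum : (G.Dart → ℂ) →ₗ[ℂ] (V → ℂ) where
  toFun f x := ∑ e : G.Dart with e.snd = x, f e
  map_add' f g := by ext e; simp [Finset.sum_add_distrib]
  map_smul' c f := by ext e; simp [Finset.mul_sum]

end Graph

/-! ### Infinite edge paths without backtracking -/

section Paths

variable {V : Type*} (G : SimpleGraph V)

/-- The space of infinite edge paths without backtracking. -/
def PathSpace : Type _ := {p : ℕ → G.Dart // ∀ n, Turn (p n) (p (n + 1))}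

variable {G}

instance : CoeFun (PathSpace G) (fun _ => ℕ → G.Dart) := ⟨Subtype.val⟩

instance : TopologicalSpace G.Dart := ⊥

instance : DiscreteTopology G.Dart := ⟨rfl⟩

/-- The topology whose basic open sets are the sets of paths with a given initial segment, that is,
the restriction of the product of the discrete topologies. -/
instance : TopologicalSpace (PathSpace G) :=
  inferInstanceAs (TopologicalSpace {p : ℕ → G.Dart // ∀ n, Turn (p n) (p (n + 1))})

theorem continuous_coord (n : ℕ) : Continuous (fun p : PathSpace G => p n) :=
  (continuous_apply n).comp continuous_subtype_val

instance [Finite G.Dart] : CompactSpace (PathSpace G) := by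
  suffices h : IsClosed {p : ℕ → G.Dart | ∀ n, Turn (p n) (p (n + 1))} from
    isCompact_iff_compactSpace.mp h.isCompact
  rw [show {p : ℕ → G.Dart | ∀ n, Turn (p n) (p (n + 1))} =
    ⋂ n, (fun p : ℕ → G.Dart => (p n, p (n + 1))) ⁻¹' {q | Turn q.1 q.2} by ext; simp]
  refine isClosed_iInter fun n => (isClosed_discrete _).preimage (by fun_prop)

/-- The district of all paths that start with the finite sequence `c` of edges. -/
def district (c : List G.Dart) : TopologicalSpace.Clopens (PathSpace G) where
  carrier := {p | ∀ i : Fin c.length, p i = c.get i}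
  isClopen' := by
    rw [show {p : PathSpace G | ∀ i : Fin c.length, p i = c.get i} =
      ⋂ i : Fin c.length, (fun p : PathSpace G => p i) ⁻¹' {c.get i} by ext; simp]
    exact isClopen_iInter_of_finite fun i => (isClopen_discrete _).preimage (continuous_coord _)

/-- Prolongation of a path by an edge in front of it. -/
def PathSpace.cons (e : G.Dart) (p : PathSpace G) (h : Turn e (p 0)) : PathSpace G :=
  ⟨fun n => Nat.casesOn n e p, fun n => by cases n with
    | zero => exact h
    | succ n => exact p.2 n⟩

/-- The path without its first `n` edges. -/
def PathSpace.drop (p : PathSpace G) (n : ℕ) : PathSpace G :=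
  ⟨fun k => p (n + k), fun k => p.2 (n + k)⟩

end Paths

/-! ### Finitely additive measures -/

section Measures

variable (X : Type*) [TopologicalSpace X]

open TopologicalSpace (Clopens)

/-- Complex-valued finitely additive measures on the clopen subsets of `X`. -/
def FAMeasure : Submodule ℂ (Clopens X → ℂ) where
  carrier := {μ | ∀ A B : Clopens X, Disjoint A B → μ (A ⊔ B) = μ A + μ B}
  zero_mem' := by intro A B _; simp
  add_mem' := by
    intro μ ν hμ hν A B h
    simp only [Pi.add_apply, hμ A B h, hν A B h]; ring
  smul_mem' := by
    intro c μ hμ A B h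
    simp only [Pi.smul_apply, hμ A B h, smul_add]

variable {X}

instance : CoeFun (FAMeasure X) (fun _ => Clopens X → ℂ) := ⟨Subtype.val⟩

/-- The level sets of a locally constant function. -/
def fiber {Y : Type*} (f : LocallyConstant X Y) (y : Y) : Clopens X :=
  ⟨f ⁻¹' {y}, f.isLocallyConstant.isClopen_fiber y⟩

/-- The integral `∫ f dμ` of a locally constant function `f` with finitely many values. -/
def integral (μ : FAMeasure X) (f : LocallyConstant X ℂ) : ℂ :=
  ∑ᶠ c : ℂ, c * μ (fiber f c)

theorem measure_bot (μ : FAMeasure X) : μ ⊥ = 0 := by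
  have := μ.2 ⊥ ⊥ disjoint_bot_left
  simpa using this

theorem measure_sup {ι : Type*} (μ : FAMeasure X) (s : Finset ι) (A : ι → Clopens X)
    (h : ∀ i j, i ≠ j → Disjoint (A i) (A j)) : μ (s.sup A) = ∑ i ∈ s, μ (A i) := by
  classical
  induction s using Finset.induction_on with
  | empty => simpa using measure_bot μ
  | insert a s ha ih =>
    rw [Finset.sup_insert, Finset.sum_insert ha, ← ih]
    refine μ.2 _ _ ?_
    rw [Finset.disjoint_sup_right]
    exact fun i hi => h a i (by rintro rfl; exact ha hi)

theorem fiber_disjoint {Y : Type*} (f : LocallyConstant X Y) (y y' : Y) (h : y ≠ y') :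
    Disjoint (fiber f y) (fiber f y') := by
  rw [disjoint_iff_inf_le]
  intro x hx
  exact (h (hx.1.symm.trans hx.2)).elim

theorem fiber_eq_bot {Y : Type*} (f : LocallyConstant X Y) (y : Y) (h : y ∉ Set.range f) :
    fiber f y = ⊥ := by
  refine le_bot_iff.mp fun x hx => (h ⟨x, hx⟩).elim

theorem integral_map {Y : Type*} (μ : FAMeasure X) (k : LocallyConstant X Y) (h : Y → ℂ)
    (hk : (Set.range k).Finite) :
    integral μ (k.map h) = ∑ y ∈ hk.toFinset, h y * μ (fiber k y) := by
  classical
  have key : ∀ c, fiber (k.map h) c = (hk.toFinset.filter (fun y => h y = c)).sup (fiber k) := by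
    intro c
    apply le_antisymm
    · intro x hx
      have h1 : fiber k (k x) ≤ (hk.toFinset.filter (fun y => h y = c)).sup (fiber k) := by
        refine Finset.le_sup (f := fiber k) ?_
        simp only [Finset.mem_filter, Set.Finite.mem_toFinset, Set.mem_range_self, true_and]
        exact hx
      exact h1 (rfl : k x = k x)
    · refine Finset.sup_le fun y hy x hx => ?_
      have h2 : h y = c := (Finset.mem_filter.mp hy).2
      have h3 : k x = y := hx
      show h (k x) = c
      rw [h3, h2]
  unfold integral
  rw [finsum_eq_sum_of_support_subset (s := hk.toFinset.image h)]
  · simp only [key, measure_sup μ _ _ (fiber_disjoint k)]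
    rw [← Finset.sum_fiberwise_of_maps_to (s := hk.toFinset) (t := hk.toFinset.image h) (g := h)
      (fun y hy => Finset.mem_image_of_mem h hy)]
    refine Finset.sum_congr rfl fun c _ => ?_
    rw [Finset.mul_sum]
    refine Finset.sum_congr rfl fun y hy => ?_
    rw [(Finset.mem_filter.mp hy).2]
  · intro c hc
    by_contra hcon
    apply hc
    show c * μ (fiber (k.map h) c) = 0
    rw [fiber_eq_bot, measure_bot, mul_zero]
    rintro ⟨x, rfl⟩
    apply hcon
    simp only [Finset.coe_image, Set.Finite.coe_toFinset]
    exact ⟨k x, ⟨x, rfl⟩, rfl⟩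

theorem integral_eq_sum (μ : FAMeasure X) (f : LocallyConstant X ℂ) (hf : (Set.range f).Finite) :
    integral μ f = ∑ c ∈ hf.toFinset, c * μ (fiber f c) :=
  integral_map μ f id hf

theorem integral_add (μ : FAMeasure X) (f g : LocallyConstant X ℂ) (hf : (Set.range f).Finite)
    (hg : (Set.range g).Finite) : integral μ (f + g) = integral μ f + integral μ g := by
  let k : LocallyConstant X (ℂ × ℂ) :=
    ⟨fun x => (f x, g x), f.isLocallyConstant.prodMk g.isLocallyConstant⟩
  have hk : (Set.range k).Finite := (hf.prod hg).subset (by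
    rintro _ ⟨x, rfl⟩; exact ⟨⟨x, rfl⟩, ⟨x, rfl⟩⟩)
  have h1 := integral_map μ k (fun q => q.1 + q.2) hk
  have h2 := integral_map μ k Prod.fst hk
  have h3 := integral_map μ k Prod.snd hk
  rw [show f + g = k.map (fun q => q.1 + q.2) from rfl, show integral μ f = _ from h2,
    show integral μ g = _ from h3, h1, ← Finset.sum_add_distrib]
  simp only [add_mul]

theorem integral_add_left (μ ν : FAMeasure X) (f : LocallyConstant X ℂ)
    (hf : (Set.range f).Finite) : integral (μ + ν) f = integral μ f + integral ν f := by
  simp only [integral_eq_sum _ f hf, ← Finset.sum_add_distrib]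
  refine Finset.sum_congr rfl fun c _ => ?_
  show c * (μ (fiber f c) + ν (fiber f c)) = _
  ring

theorem integral_smul_left (a : ℂ) (μ : FAMeasure X) (f : LocallyConstant X ℂ)
    (hf : (Set.range f).Finite) : integral (a • μ) f = a * integral μ f := by
  simp only [integral_eq_sum _ f hf, Finset.mul_sum]
  refine Finset.sum_congr rfl fun c _ => ?_
  show c * (a * μ (fiber f c)) = _
  ring

/-- The characteristic function of a clopen set. -/
def charFn (A : Clopens X) : LocallyConstant X ℂ := LocallyConstant.charFn ℂ A.isClopen

theorem charFn_sup (A B : Clopens X) (h : Disjoint A B) :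
    charFn (A ⊔ B) = charFn A + charFn B := by
  ext x
  have hd : Disjoint (A : Set X) (B : Set X) := by
    rw [Set.disjoint_left]
    intro x hA hB
    exact (disjoint_iff_inf_le.mp h) (show x ∈ A ⊓ B from ⟨hA, hB⟩)
  exact congrFun (Set.indicator_union_of_disjoint hd (1 : X → ℂ)) x

theorem charFn_range (A : Clopens X) : (Set.range (charFn A)).Finite := by
  refine (Set.toFinite {0, 1}).subset ?_
  rintro _ ⟨x, rfl⟩
  by_cases hx : x ∈ (A : Set X)
  · right; exact Set.indicator_of_mem hx _
  · left; exact Set.indicator_of_notMem hx _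

theorem mul_range (f g : LocallyConstant X ℂ) (hf : (Set.range f).Finite)
    (hg : (Set.range g).Finite) : (Set.range (f * g)).Finite :=
  (Set.Finite.image2 (· * ·) hf hg).subset (by
    rintro _ ⟨x, rfl⟩; exact ⟨f x, ⟨x, rfl⟩, g x, ⟨x, rfl⟩, rfl⟩)

/-- The product `f μ` of a measure by a locally constant function with finitely many values:
`(f μ)(A) = ∫_A f dμ`. -/
def density (f : LocallyConstant X ℂ) (hf : (Set.range f).Finite) :
    FAMeasure X →ₗ[ℂ] FAMeasure X where
  toFun μ := ⟨fun A => integral μ (charFn A * f), by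
    intro A B h
    show integral μ _ = _
    rw [charFn_sup A B h, add_mul, integral_add]
    exacts [mul_range _ _ (charFn_range A) hf, mul_range _ _ (charFn_range B) hf]⟩
  map_add' μ ν := by
    ext A; exact integral_add_left μ ν _ (mul_range _ _ (charFn_range A) hf)
  map_smul' a μ := by
    ext A; exact integral_smul_left a μ _ (mul_range _ _ (charFn_range A) hf)

/-- The image of a measure under a continuous map. -/
def pushforward {Y : Type*} [TopologicalSpace Y] (f : C(X, Y)) :
    FAMeasure X →ₗ[ℂ] FAMeasure Y where
  toFun μ := ⟨fun A => μ ⟨f ⁻¹' A, A.isClopen.preimage f.continuous⟩, by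
    intro A B h
    refine μ.2 ⟨f ⁻¹' A, A.isClopen.preimage f.continuous⟩
      ⟨f ⁻¹' B, B.isClopen.preimage f.continuous⟩ ?_
    rw [disjoint_iff_inf_le] at h ⊢
    exact fun x hx => h (show f x ∈ A ⊓ B from hx)⟩
  map_add' _ _ := rfl
  map_smul' _ _ := rfl

/-- The restriction of a measure to a clopen subspace. -/
def restrictTo (U : Clopens X) : FAMeasure X →ₗ[ℂ] FAMeasure U where
  toFun μ := ⟨fun A => μ ⟨Subtype.val '' (A : Set U),
      U.isClopen.isClosed.isClosedMap_subtype_val _ A.isClopen.isClosed,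
      U.isClopen.isOpen.isOpenMap_subtype_val _ A.isClopen.isOpen⟩, by
    intro A B h
    show μ _ = μ _ + μ _
    rw [← μ.2]
    · refine congrArg μ.1 (TopologicalSpace.Clopens.ext ?_)
      exact Set.image_union _ _ _
    · rw [disjoint_iff_inf_le] at h ⊢
      rintro x ⟨⟨a, ha, rfl⟩, ⟨b, hb, hab⟩⟩
      obtain rfl : b = a := Subtype.ext hab
      exact (h (show b ∈ A ⊓ B from ⟨ha, hb⟩)).elim⟩
  map_add' _ _ := rfl
  map_smul' _ _ := rfl

end Measures

/-! ### The transfer operator and its dual -/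

section Transfer

variable {V : Type*} [Fintype V] [DecidableEq V] (G : SimpleGraph V) [DecidableRel G.Adj]

/-- The transfer operator on functions on the path space. -/
def transfer : (PathSpace G → ℂ) →ₗ[ℂ] (PathSpace G → ℂ) where
  toFun f p := ∑ e : G.Dart, if h : Turn e (p 0) then f (p.cons e h) else 0
  map_add' f g := by
    ext p
    simp only [Pi.add_apply, ← Finset.sum_add_distrib]
    refine Finset.sum_congr rfl fun e _ => ?_
    split_ifs <;> simp
  map_smul' c f := by
    ext p
    simp only [Pi.smul_apply, smul_eq_mul, RingHom.id_apply, Finset.mul_sum]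
    refine Finset.sum_congr rfl fun e _ => ?_
    split_ifs <;> simp

theorem transfer_isLocallyConstant (f : PathSpace G → ℂ) (hf : IsLocallyConstant f) :
    IsLocallyConstant (transfer G f) := by
  rw [IsLocallyConstant.iff_eventually_eq]
  intro p
  have h0 : ∀ᶠ q in 𝓝 p, q 0 = p 0 :=
    (continuous_coord 0).continuousAt.eventually
      ((isOpen_discrete ({p 0} : Set G.Dart)).mem_nhds rfl)
  have hterm : ∀ e : G.Dart, ∀ᶠ q in 𝓝 p,
      (if h : Turn e (q 0) then f (q.cons e h) else 0) =
        (if h : Turn e (p 0) then f (p.cons e h) else 0) := by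
    intro e
    by_cases h : Turn e (p 0)
    · let U : Set (PathSpace G) := {q | Turn e (q 0)}
      have hU : IsOpen U :=
        (isOpen_discrete {d : G.Dart | Turn e d}).preimage (continuous_coord 0)
      let F : U → PathSpace G := fun q => q.1.cons e q.2
      have hF : Continuous F := by
        refine Continuous.subtype_mk (continuous_pi fun n => ?_) _
        cases n with
        | zero => exact continuous_const
        | succ n => exact (continuous_coord n).comp continuous_subtype_val
      have h1 : ∀ᶠ q in 𝓝 (⟨p, h⟩ : U), f (F q) = f (F ⟨p, h⟩) :=
        (IsLocallyConstant.iff_eventually_eq _).1 (hf.comp_continuous hF) ⟨p, h⟩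
      have h2 : ∀ᶠ q in 𝓝 p, ∀ hq : q ∈ U, f (F ⟨q, hq⟩) = f (F ⟨p, h⟩) := by
        have h3 := h1
        rw [nhds_subtype_eq_comap, Filter.eventually_comap] at h3
        filter_upwards [h3] with q hq hqU
        exact hq ⟨q, hqU⟩ rfl
      filter_upwards [h2, hU.mem_nhds h] with q hq hqU
      rw [dif_pos (show Turn e (q 0) from hqU), dif_pos h]
      exact hq hqU
    · filter_upwards [h0] with q hq
      rw [dif_neg h, dif_neg (hq ▸ h)]
  filter_upwards [Filter.eventually_all.2 hterm] with q hq
  exact Finset.sum_congr rfl fun e _ => hq e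

/-- The transfer operator on locally constant functions. -/
def transferLC (f : LocallyConstant (PathSpace G) ℂ) : LocallyConstant (PathSpace G) ℂ :=
  ⟨transfer G f, transfer_isLocallyConstant G f f.isLocallyConstant⟩

/-- The dual transfer operator on finitely additive measures: `(L'μ)(A) = ⟨L 1_A, μ⟩`. -/
def dualTransfer : FAMeasure (PathSpace G) →ₗ[ℂ] FAMeasure (PathSpace G) where
  toFun μ := ⟨fun A => integral μ (transferLC G (charFn A)), by
    intro A B h
    show integral μ _ = _
    rw [charFn_sup A B h, show transferLC G (charFn A + charFn B) =
      transferLC G (charFn A) + transferLC G (charFn B) from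
        LocallyConstant.coe_injective ((transfer G).map_add _ _),
      integral_add _ _ _ (LocallyConstant.range_finite _) (LocallyConstant.range_finite _)]⟩
  map_add' μ ν := by
    ext A; exact integral_add_left μ ν _ (LocallyConstant.range_finite _)
  map_smul' a μ := by
    ext A; exact integral_smul_left a μ _ (LocallyConstant.range_finite _)

end Transfer

/-! ### The boundary of a tree, horocycle brackets and the Poisson transform -/

section Tree

variable {W : Type*} (T : SimpleGraph W)

/-- Two rays are confluent if they eventually coincide (up to a shift of the parameter). -/
def confluent : Setoid (PathSpace T) where
  r p q := ∃ m n, ∀ k, p (m + k) = q (n + k)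
  iseqv :=
    { refl := fun _ => ⟨0, 0, fun _ => rfl⟩
      symm := fun ⟨m, n, h⟩ => ⟨n, m, fun k => (h k).symm⟩
      trans := by
        rintro p q r ⟨m, n, h⟩ ⟨m', n', h'⟩
        refine ⟨m + m', n' + n, fun k => ?_⟩
        rw [show m + m' + k = m + (m' + k) by ring, h,
          show n + (m' + k) = m' + (n + k) by ring, h', add_assoc] }

/-- The boundary of a tree: the set of confluence classes of rays. -/
def Boundary : Type _ := Quotient (confluent T)

variable {T}

/-- The end of a ray. -/
def endOf (p : PathSpace T) : Boundary T := Quotient.mk (confluent T) p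

/-- The forward set of an oriented edge: the ends of the rays that start with this edge. -/
def forwardSet (e : T.Dart) : Set (Boundary T) := {ω | ∃ p : PathSpace T, p 0 = e ∧ endOf p = ω}

instance : TopologicalSpace (Boundary T) := TopologicalSpace.generateFrom (Set.range forwardSet)

theorem endOf_drop (p : PathSpace T) (n : ℕ) : endOf (p.drop n) = endOf p :=
  Quotient.sound ⟨0, n, fun k => congrArg (fun i => p (n + i)) (zero_add k)⟩

theorem isOpen_forwardSet (e : T.Dart) : IsOpen (forwardSet e) :=
  TopologicalSpace.isOpen_generateFrom_of_mem ⟨e, rfl⟩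

/-- The number `⟨x, y⟩_ω`: the common value of `d(x, w) - d(y, w)` for all vertices `w` far out on a
ray that represents the end `ω`; such `w` lie on both the ray from `x` to `ω` and the ray from `y`
to `ω`. -/
def horoDist (ω : Boundary T) (x y : W) : ℤ :=
  Quotient.liftOn ω
    (fun p => Filter.limUnder Filter.atTop fun n => (T.dist x (p n).fst : ℤ) - T.dist y (p n).fst) (by
      rintro p q ⟨m, n, h⟩
      unfold Filter.limUnder
      congr 1
      conv_lhs => rw [← Filter.map_add_atTop_eq_nat m, Filter.map_map]
      conv_rhs => rw [← Filter.map_add_atTop_eq_nat n, Filter.map_map]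
      congr 1
      funext k
      simp only [Function.comp_apply, add_comm k m, add_comm k n, h k])

/-- The oriented edge `e` points away from the vertex `x`. -/
def PointsAway (e : T.Dart) (x : W) : Prop := T.dist x e.snd = T.dist x e.fst + 1

theorem eq_of_closer (hT : T.IsTree) {x v a b : W} (ha : T.Adj a v) (hb : T.Adj b v)
    (hda : T.dist x v = T.dist x a + 1) (hdb : T.dist x v = T.dist x b + 1) : a = b := by
  obtain ⟨p, hp⟩ := hT.connected.exists_walk_length_eq_dist x a
  obtain ⟨q, hq⟩ := hT.connected.exists_walk_length_eq_dist x b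
  have h1 : (p.concat ha).IsPath := SimpleGraph.Walk.isPath_of_length_eq_dist _ (by
    rw [SimpleGraph.Walk.length_concat, hp, hda])
  have h2 : (q.concat hb).IsPath := SimpleGraph.Walk.isPath_of_length_eq_dist _ (by
    rw [SimpleGraph.Walk.length_concat, hq, hdb])
  have h3 := (hT.existsUnique_path x v).unique h1 h2
  have h4 := congrArg SimpleGraph.Walk.penultimate h3
  simpa using h4

theorem PointsAway.turn (hT : T.IsTree) {x : W} {e e' : T.Dart} (h : Turn e e')
    (he : PointsAway e x) : PointsAway e' x := by
  rcases hT.dist_eq_dist_add_one_of_adj x e'.adj with h1 | h1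
  · exfalso
    have hadj : T.Adj e'.snd e.snd := h.1 ▸ e'.adj.symm
    have h2 : e.fst = e'.snd := eq_of_closer hT e.adj hadj he (by rw [h.1, h1])
    apply h.2
    ext
    · exact h2
    · exact h.1
  · exact h1

theorem pointsAway_path (hT : T.IsTree) {x : W} (p : PathSpace T) {N : ℕ}
    (h : PointsAway (p N) x) (k : ℕ) : PointsAway (p (N + k)) x ∧
      T.dist x (p (N + k)).fst = T.dist x (p N).fst + k := by
  induction k with
  | zero => exact ⟨h, rfl⟩
  | succ k ih =>
    refine ⟨ih.1.turn hT (p.2 _), ?_⟩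
    have h1 : (p (N + k)).snd = (p (N + (k + 1))).fst := (p.2 (N + k)).1
    have h2 : T.dist x (p (N + k)).snd = T.dist x (p (N + k)).fst + 1 := ih.1
    rw [← h1, h2, ih.2, add_assoc]

theorem exists_pointsAway (hT : T.IsTree) (x : W) (p : PathSpace T) :
    ∃ N, PointsAway (p N) x := by
  by_contra hcon
  push Not at hcon
  have h1 : ∀ n, T.dist x (p n).fst + n = T.dist x (p 0).fst := by
    intro n
    induction n with
    | zero => rfl
    | succ n ih =>
      have h2 : (p n).snd = (p (n + 1)).fst := (p.2 n).1
      rcases hT.dist_eq_dist_add_one_of_adj x (p n).adj with h3 | h3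
      · rw [← h2]; omega
      · exact (hcon n h3).elim
  have := h1 (T.dist x (p 0).fst + 1)
  omega

theorem horoDist_eq (hT : T.IsTree) {x y : W} {e : T.Dart} (hx : PointsAway e x)
    (hy : PointsAway e y) {ω : Boundary T} (hω : ω ∈ forwardSet e) :
    horoDist ω x y = (T.dist x e.fst : ℤ) - T.dist y e.fst := by
  obtain ⟨p, rfl, rfl⟩ := hω
  refine Filter.Tendsto.limUnder_eq (tendsto_const_nhds.congr fun n => ?_)
  have h1 := (pointsAway_path hT p hx n).2
  have h2 := (pointsAway_path hT p hy n).2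
  rw [zero_add] at h1 h2
  rw [h1, h2]
  push_cast
  ring

theorem exists_forwardSet (hT : T.IsTree) (x y : W) (ω : Boundary T) :
    ∃ e : T.Dart, PointsAway e x ∧ PointsAway e y ∧ ω ∈ forwardSet e := by
  induction ω using Quotient.inductionOn with
  | h p =>
    obtain ⟨M, hM⟩ := exists_pointsAway hT x p
    obtain ⟨N, hN⟩ := exists_pointsAway hT y p
    refine ⟨p (M + N), (pointsAway_path hT p hM N).1, ?_, p.drop (M + N), rfl, endOf_drop p _⟩
    rw [add_comm]
    exact (pointsAway_path hT p hN M).1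

/-- The locally constant function `ω ↦ z ^ ⟨x, y⟩_ω` on the boundary. -/
def kernel (hT : T.IsTree) (z : ℂ) (x y : W) : LocallyConstant (Boundary T) ℂ where
  toFun ω := z ^ horoDist ω x y
  isLocallyConstant := by
    rw [IsLocallyConstant.iff_exists_open]
    intro ω
    obtain ⟨e, hx, hy, hω⟩ := exists_forwardSet hT x y ω
    refine ⟨forwardSet e, isOpen_forwardSet e, hω, fun ω' hω' => ?_⟩
    rw [horoDist_eq hT hx hy hω, horoDist_eq hT hx hy hω']

theorem kernel_range (hT : T.IsTree) (z : ℂ) (x y : W) :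
    (Set.range (kernel hT z x y)).Finite := by
  refine ((Set.finite_Icc (-(T.dist x y : ℤ)) (T.dist x y)).image (fun k => z ^ k)).subset ?_
  rintro _ ⟨ω, rfl⟩
  refine ⟨horoDist ω x y, ?_, rfl⟩
  obtain ⟨e, hx, hy, hω⟩ := exists_forwardSet hT x y ω
  rw [horoDist_eq hT hx hy hω]
  have h1 := hT.connected.dist_triangle (u := x) (v := y) (w := e.fst)
  have h2 := hT.connected.dist_triangle (u := y) (v := x) (w := e.fst)
  rw [SimpleGraph.dist_comm (u := y) (v := x)] at h2
  constructor <;> omega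

/-- The Poisson transform with base vertex `b`: `(P μ)(x) = ∫ z ^ ⟨b, x⟩_ω dμ(ω)`. -/
def poisson (hT : T.IsTree) (b : W) (z : ℂ) : FAMeasure (Boundary T) →ₗ[ℂ] (W → ℂ) where
  toFun μ x := integral μ (kernel hT z b x)
  map_add' μ ν := by ext x; exact integral_add_left μ ν _ (kernel_range hT z b x)
  map_smul' a μ := by ext x; exact integral_smul_left a μ _ (kernel_range hT z b x)

/-- The action of a tree automorphism on rays. -/
def rayMap (γ : T ≃g T) (p : PathSpace T) : PathSpace T :=
  ⟨fun n => γ.toHom.mapDart (p n), fun n => by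
    refine ⟨congrArg γ (p.2 n).1, fun h => (p.2 n).2 ?_⟩
    have h1 : γ (p n).fst = γ (p (n + 1)).snd := congrArg (fun d => d.fst) h
    have h2 : γ (p n).snd = γ (p (n + 1)).fst := congrArg (fun d => d.snd) h
    ext
    · exact γ.injective h1
    · exact γ.injective h2⟩

theorem rayMap_confluent (γ : T ≃g T) {p q : PathSpace T} (h : endOf p = endOf q) :
    endOf (rayMap γ p) = endOf (rayMap γ q) := by
  obtain ⟨m, n, h⟩ := Quotient.exact h
  exact Quotient.sound ⟨m, n, fun k => congrArg γ.toHom.mapDart (h k)⟩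

theorem rayMap_symm (γ : T ≃g T) (p : PathSpace T) : rayMap γ.symm (rayMap γ p) = p := by
  apply Subtype.ext
  funext n
  ext
  · exact γ.symm_apply_apply _
  · exact γ.symm_apply_apply _

/-- The action of a tree automorphism on the boundary. -/
def boundaryMap (γ : T ≃g T) : C(Boundary T, Boundary T) where
  toFun := Quotient.map' (s₁ := confluent T) (s₂ := confluent T) (rayMap γ)
    fun _ _ h => Quotient.exact (rayMap_confluent γ (Quotient.sound h))
  continuous_toFun := by
    refine continuous_generateFrom_iff.2 ?_
    rintro _ ⟨e, rfl⟩
    convert isOpen_forwardSet (γ.symm.toHom.mapDart e) using 1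
    ext ω
    induction ω using Quotient.inductionOn with
    | h p =>
      constructor
      · rintro ⟨q, hq, hqp⟩
        refine ⟨rayMap γ.symm q, congrArg γ.symm.toHom.mapDart hq, ?_⟩
        rw [rayMap_confluent γ.symm (show endOf q = endOf (rayMap γ p) from hqp), rayMap_symm]
        rfl
      · rintro ⟨q, hq, hqp⟩
        refine ⟨rayMap γ q, ?_, rayMap_confluent γ hqp⟩
        show γ.toHom.mapDart (q 0) = e
        rw [hq]
        ext
        · exact γ.apply_symm_apply _
        · exact γ.apply_symm_apply _

/-- The twisted representation on measures: `γ` acts by `μ ↦ z ^ ⟨γ b, b⟩_ω · γμ`, where `γμ` is the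
image measure. -/
def twistedAction (hT : T.IsTree) (b : W) (z : ℂ) (γ : T ≃g T) :
    FAMeasure (Boundary T) →ₗ[ℂ] FAMeasure (Boundary T) :=
  density (kernel hT z (γ b) b) (kernel_range hT z (γ b) b) ∘ₗ pushforward (boundaryMap γ)

/-- The measures fixed by a group of automorphisms under the twisted representation. -/
def twistedInvariants (hT : T.IsTree) (b : W) (z : ℂ) (Γ : Subgroup (T ≃g T)) :
    Submodule ℂ (FAMeasure (Boundary T)) :=
  ⨅ γ ∈ Γ, LinearMap.eqLocus (twistedAction hT b z γ) LinearMap.id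

/-- The functions on the vertices that are fixed by a group of automorphisms. -/
def invariantFunctions (Γ : Subgroup (T ≃g T)) : Submodule ℂ (W → ℂ) where
  carrier := {φ | ∀ γ ∈ Γ, ∀ x, φ (γ⁻¹ x) = φ x}
  zero_mem' := fun _ _ _ => rfl
  add_mem' := fun hφ hψ γ hγ x => by simp only [Pi.add_apply, hφ γ hγ x, hψ γ hγ x]
  smul_mem' := fun c φ hφ γ hγ x => by simp only [Pi.smul_apply, hφ γ hγ x]

end Tree

/-! ### The universal cover -/

section Cover

variable {V : Type*} (G : SimpleGraph V) (o : V)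

/-- The vertices of the universal cover: finite (possibly empty) edge paths without backtracking
that start at `o`. -/
def CoverVertex : Type _ :=
  {c : List G.Dart // c.IsChain Turn ∧ ∀ e ∈ c.head?, e.fst = o}

/-- The universal cover: two vertices are adjacent if one of them extends the other by one edge. -/
def cover : SimpleGraph (CoverVertex G o) where
  Adj c d := (∃ e, d.1 = c.1 ++ [e]) ∨ ∃ e, c.1 = d.1 ++ [e]
  symm := ⟨fun _ _ h => h.symm⟩
  loopless := ⟨fun c h => by rcases h with ⟨e, h⟩ | ⟨e, h⟩ <;> simp at h⟩

variable {G o}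

/-- The covering projection sends a path to its end point. -/
def coverProj (c : CoverVertex G o) : V := (c.1.getLast?).elim o (fun e => e.snd)

/-- The base vertex of the universal cover is the empty path. -/
def coverBase : CoverVertex G o := ⟨[], by simp⟩

variable (G o)

/-- The fundamental group, acting on the universal cover as the group of deck transformations. -/
def deckGroup : Subgroup (cover G o ≃g cover G o) where
  carrier := {γ | ∀ x, coverProj (γ x) = coverProj x}
  mul_mem' := fun {γ δ} hγ hδ x => (hγ (δ x)).trans (hδ x)
  one_mem' := fun _ => rfl
  inv_mem' := fun {γ} hγ x => by
    have h := hγ (γ⁻¹ x)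
    rw [RelIso.apply_inv_self] at h
    exact h.symm

theorem cover_adj_length {c d : CoverVertex G o} (h : (cover G o).Adj c d) :
    c.1.length ≠ d.1.length := by
  rcases h with ⟨e, h⟩ | ⟨e, h⟩ <;> simp [h]

theorem cover_adj_dropLast {c d : CoverVertex G o} (h : (cover G o).Adj c d)
    (hl : d.1.length ≤ c.1.length) : d.1 = c.1.dropLast := by
  rcases h with ⟨e, h⟩ | ⟨e, h⟩
  · rw [h] at hl; simp at hl
  · rw [h]; simp

theorem cover_isTree : (cover G o).IsTree := by
  constructor
  · have hreach : ∀ n, ∀ c : CoverVertex G o, c.1.length = n →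
        (cover G o).Reachable c coverBase := by
      intro n
      induction n with
      | zero =>
        intro c hc
        obtain rfl : c = coverBase := Subtype.ext (List.length_eq_zero_iff.1 hc)
        exact SimpleGraph.Reachable.refl _
      | succ n ih =>
        intro c hc
        have hne : c.1 ≠ [] := by rintro h; simp [h] at hc
        have hsplit : c.1 = c.1.dropLast ++ [c.1.getLast hne] :=
          (List.dropLast_append_getLast hne).symm
        have hd : c.1.dropLast.IsChain Turn ∧ ∀ e ∈ c.1.dropLast.head?, e.fst = o := by
          have h1 := c.2
          rw [hsplit] at h1
          refine ⟨h1.1.left_of_append, fun e he => h1.2 e ?_⟩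
          rw [List.head?_append, Option.mem_def.1 he]
          rfl
        have hadj : (cover G o).Adj c ⟨c.1.dropLast, hd⟩ := Or.inr ⟨_, hsplit⟩
        exact hadj.reachable.trans (ih _ (by simp [hc]))
    have : Nonempty (CoverVertex G o) := ⟨coverBase⟩
    exact ⟨fun c d => (hreach _ c rfl).trans (hreach _ d rfl).symm⟩
  · intro v c hc
    classical
    obtain ⟨u, hu, hmax⟩ := c.support.toFinset.exists_max_image (fun u => u.1.length)
      ⟨v, by simp⟩
    have hu' : u ∈ c.support := List.mem_toFinset.1 hu
    have hc' := hc.rotate hu'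
    have hle : ∀ w ∈ (c.rotate u hu').support, w.1.length ≤ u.1.length := by
      intro w hw
      refine hmax w (List.mem_toFinset.2 ?_)
      simpa using hw
    have h1 := cover_adj_dropLast G o (SimpleGraph.Walk.adj_snd hc'.not_nil)
      (hle _ (SimpleGraph.Walk.getVert_mem_support _ _))
    have h2 := cover_adj_dropLast G o (SimpleGraph.Walk.adj_penultimate hc'.not_nil).symm
      (hle _ (SimpleGraph.Walk.getVert_mem_support _ _))
    exact hc'.snd_ne_penultimate (Subtype.ext (h1.trans h2.symm))

instance [Finite G.Dart] : (cover G o).LocallyFinite := fun c =>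
  @Fintype.ofFinite _ (by
    refine Set.Finite.to_subtype ?_
    refine Set.Finite.of_finite_image (f := Subtype.val) (Set.Finite.subset
      ((Set.finite_range (fun e : G.Dart => c.1 ++ [e])).union
        (Set.finite_singleton c.1.dropLast)) ?_) Subtype.val_injective.injOn
    rintro _ ⟨d, hd, rfl⟩
    rcases hd with ⟨e, h⟩ | ⟨e, h⟩
    · left; exact ⟨e, h.symm⟩
    · right; simp [h])

/-- The island of all infinite paths that start at `o`. -/
def island : TopologicalSpace.Clopens (PathSpace G) where
  carrier := {p | (p 0).fst = o}
  isClopen' := (isClopen_discrete {e : G.Dart | e.fst = o}).preimage (continuous_coord 0)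

variable {G o}

/-- The initial segment of length `n` of an infinite path, as a vertex of the universal cover. -/
def initialSegment (p : island G o) (n : ℕ) : CoverVertex G o :=
  ⟨(List.range n).map p.1, by
    refine ⟨?_, ?_⟩
    · rw [List.isChain_iff_getElem]
      intro i hi
      simpa using p.1.2 i
    · intro e he
      cases n with
      | zero => simp at he
      | succ n =>
        have h : (p.1 0).fst = o := p.2
        simp [List.range_succ_eq_map] at he
        rw [← he, h]⟩

/-- The lift of an infinite path that starts at `o` to a ray that starts at the base vertex. -/
def liftPath (p : island G o) : PathSpace (cover G o) :=
  ⟨fun n => ⟨(initialSegment p n, initialSegment p (n + 1)),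
      Or.inl ⟨p.1 n, by simp [initialSegment, List.range_succ]⟩⟩, fun n => by
    refine ⟨rfl, fun h => ?_⟩
    have h1 : initialSegment p n = initialSegment p (n + 2) := congrArg (fun d => d.fst) h
    have h2 := congrArg (fun c => c.1.length) h1
    simp [initialSegment] at h2⟩

/-- The identification of the island of `o` with the boundary of the universal cover. -/
def islandToBoundary : C(island G o, Boundary (cover G o)) where
  toFun p := endOf (liftPath p)
  continuous_toFun := by
    refine continuous_generateFrom_iff.2 ?_
    rintro _ ⟨e, rfl⟩
    rw [isOpen_iff_mem_nhds]
    rintro p ⟨r, hr, hrp⟩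
    obtain ⟨m, n, h⟩ := Quotient.exact hrp
    have hnear : ∀ᶠ q : island G o in 𝓝 p, ∀ i ∈ Finset.range (n + 1), q.1 i = p.1 i := by
      rw [Finset.eventually_all]
      intro i _
      exact ((continuous_coord i).comp continuous_subtype_val).continuousAt.eventually
        ((isOpen_discrete ({p.1 i} : Set G.Dart)).mem_nhds rfl)
    filter_upwards [hnear] with q hq
    have hseg : ∀ j ≤ n + 1, initialSegment q j = initialSegment p j := by
      intro j hj
      refine Subtype.ext (List.map_congr_left fun i hi => hq i ?_)
      have := List.mem_range.1 hi
      exact Finset.mem_range.2 (by omega)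
    have hn : liftPath q n = r m := by
      rw [show r m = liftPath p n from h 0]
      ext
      · exact hseg n (by omega)
      · exact hseg (n + 1) le_rfl
    refine ⟨⟨fun k => if k < m then r k else liftPath q (n + (k - m)), fun k => ?_⟩, ?_,
      Quotient.sound ⟨m, n, fun k => ?_⟩⟩
    · by_cases h1 : k + 1 < m
      · simp only [h1, show k < m by omega, if_true]
        exact r.2 k
      · by_cases h2 : k + 1 = m
        · subst h2
          simpa [hn] using r.2 k
        · simp only [h1, show ¬ k < m by omega, if_false]
          rw [show n + (k + 1 - m) = n + (k - m) + 1 by omega]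
          exact (liftPath q).2 _
    · by_cases h1 : 0 < m
      · simpa [h1] using hr
      · obtain rfl : m = 0 := by omega
        simpa [hn] using hr
    · show (if m + k < m then r (m + k) else liftPath q (n + (m + k - m))) = _
      rw [if_neg (by omega), show n + (m + k - m) = n + k by omega]

variable (G o)

/-- The restriction homomorphism: a measure on the path space is restricted to the island of `o`
and then regarded as a measure on the boundary of the universal cover. -/
def restriction : FAMeasure (PathSpace G) →ₗ[ℂ] FAMeasure (Boundary (cover G o)) :=
  pushforward islandToBoundary ∘ₗ restrictTo (island G o)

end Cover

end GraphSpectral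

end

open GraphSpectral

namespace GraphSpectral

/-! ### Turns, incoming sums and the twisted gradient -/

section LocalOperators

variable {V : Type*} {G : SimpleGraph V}

/-! All five spaces are controlled by one function on the oriented edges, f(e) = μ(P_ē).

Eigenmeasures and edge functions: on districts the dual transfer operator forgets the first edge,
(L'μ)(P_{e→e'→c}) = μ(P_{e'→c}), and on a single edge it is the turn sum read backwards. So L'μ = zμ
forces a factor z⁻¹ per forgotten edge (`eigenmeasure_district`): μ is determined by f, and Sf = zf.
Conversely, given f, take a combination of point masses with edge masses f and iterate z⁻¹L'. Edge
masses are preserved, the value on a district becomes constant after finitely many steps, and by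
compactness every clopen set is a finite disjoint union of districts. The limit is the required
eigenmeasure (`exists_eigenmeasure`); no consistency condition has to be checked by hand.

Edge functions and vertex functions: Sf = zf says (𝓘f)(ι(e)) = z f(e) + f(ē). The equations at e and
ē form a 2×2 system of determinant z² − 1; solving it for f(e) gives (z − z⁻¹)⁻¹∇_z. This is where z
≠ ±1 is needed.

Lifting: the projection of the cover is bijective on neighborhoods and the deck group is transitive
on its fibers (`exists_deck`), so invariant functions descend.

Restriction: let the vertex d of the cover extend c by the edge e, and let a deck transformation
carry c, d to c', d', where d' extends c'. The twist on the ends beyond d' is the constant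
z^(|c|−|c'|), so invariance of ν says that z^|c| ν(cylinder of d) depends only on e
(`pow_mul_cylinder_eq`). Read with reversed edges, this is an edge function, and additivity of ν is
its eigenvalue equation. Connectedness and degrees at least 2 make every e occur
(`exists_cover_concat`).

Poisson transform: when y extends x by one edge, ⟨õ,y⟩ exceeds ⟨õ,x⟩ by 1 on the cylinder of y and
by −1 elsewhere. Integrating, P_z ν satisfies the same recursion along the tree as (𝓘f)∘p, with the
same value at õ (`poisson_restriction`). Thus the square commutes, and P_z is bijective because the
other four maps are. -/

theorem turn_symm_iff {e e' : G.Dart} : Turn e'.symm e.symm ↔ Turn e e' := by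
  constructor
  · rintro ⟨h1, h2⟩
    exact ⟨h1.symm, fun h => h2 (by simp [h])⟩
  · rintro ⟨h1, h2⟩
    exact ⟨h1.symm, fun h => h2 (by rw [h]; simp)⟩

theorem dart_ext {e e' : G.Dart} (h1 : e.fst = e'.fst) (h2 : e.snd = e'.snd) : e = e' := by
  ext
  · exact h1
  · exact h2

/-- On a graph without isolated vertices, dividing both operators by the degree does not change
their equalizer. -/
theorem eqLocus_neighborSum_rescale [G.LocallyFinite] (hdeg : ∀ x, G.degree x ≠ 0) (z : ℂ) :
    LinearMap.eqLocus (neighborSum G) (rescale G z) =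
      LinearMap.eqLocus (neighborAvg G) (localTweak G z) := by
  ext φ
  simp only [LinearMap.mem_eqLocus, funext_iff]
  refine forall_congr' fun x => ?_
  have hx : (G.degree x : ℂ) ≠ 0 := by exact_mod_cast hdeg x
  show ∑ y ∈ G.neighborFinset x, φ y = (z + ((G.degree x : ℂ) - 1) * z⁻¹) * φ x ↔
    (1 / (G.degree x : ℂ)) * ∑ y ∈ G.neighborFinset x, φ y =
      ((z + ((G.degree x : ℂ) - 1) * z⁻¹) / (G.degree x : ℂ)) * φ x
  rw [one_div_mul_eq_div, div_mul_eq_mul_div, div_left_inj' hx]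

variable [Fintype V] [DecidableEq V] [DecidableRel G.Adj]

/-- Of all edges ending at ι(e), exactly ē fails to make a turn into e. -/
theorem turnSum_apply (f : G.Dart → ℂ) (e : G.Dart) :
    turnSum G f e = inSum G f e.fst - f e.symm := by
  have h : (Finset.univ.filter fun e' : G.Dart => Turn e' e) =
      (Finset.univ.filter fun e' : G.Dart => e'.snd = e.fst).erase e.symm := by
    ext e'
    rw [Finset.mem_erase, Finset.mem_filter, Finset.mem_filter]
    simp [Turn, and_comm]
  show ∑ e' : G.Dart with Turn e' e, f e' = (∑ e' : G.Dart with e'.snd = e.fst, f e') - f e.symm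
  rw [h, Finset.sum_erase_eq_sub (by simp)]

theorem neighborSum_eq_sum_darts (φ : V → ℂ) (x : V) :
    neighborSum G φ x = ∑ e : G.Dart with e.snd = x, φ e.fst := by
  symm
  refine Finset.sum_bij (fun e _ => e.fst) ?_ ?_ ?_ fun _ _ => rfl
  · intro e he
    obtain rfl := (Finset.mem_filter.1 he).2
    simpa using e.adj.symm
  · intro e he e' he' h
    exact dart_ext h ((Finset.mem_filter.1 he).2.trans (Finset.mem_filter.1 he').2.symm)
  · intro y hy
    exact ⟨⟨(y, x), ((G.mem_neighborFinset x y).1 hy).symm⟩, by simp, rfl⟩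

theorem sum_darts_const (x : V) (a : ℂ) :
    ∑ e : G.Dart with e.snd = x, a = G.degree x * a := by
  rw [← neighborSum_eq_sum_darts (fun _ => a)]
  show ∑ y ∈ G.neighborFinset x, a = _
  simp

/-- Used at e and at ē together, this is a linear system for f(e) and f(ē) in terms of the incoming
sums at the two end points. -/
theorem mem_eigenspace_turnSum {z : ℂ} {f : G.Dart → ℂ} :
    f ∈ Module.End.eigenspace (turnSum G) z ↔
      ∀ e : G.Dart, inSum G f e.fst = z * f e + f e.symm := by
  rw [Module.End.mem_eigenspace_iff, funext_iff]
  refine forall_congr' fun e => ?_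
  rw [turnSum_apply, sub_eq_iff_eq_add]
  rfl

/-- Eliminating f(ē) from the equations at e and ē expresses the incoming sum at ι(e) through the
one at x = τ(e) and f(e). Summing over the edges into x, the terms f(e) reassemble into the incoming
sum at x. -/
theorem inSum_mem {z : ℂ} (hz : z ≠ 0) {f : G.Dart → ℂ}
    (hf : f ∈ Module.End.eigenspace (turnSum G) z) :
    inSum G f ∈ LinearMap.eqLocus (neighborSum G) (rescale G z) := by
  rw [mem_eigenspace_turnSum] at hf
  rw [LinearMap.mem_eqLocus]
  ext x
  rw [neighborSum_eq_sum_darts]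
  have h1 : ∀ e ∈ Finset.univ.filter (fun e : G.Dart => e.snd = x),
      inSum G f e.fst = z⁻¹ * inSum G f x + (z - z⁻¹) * f e := by
    intro e he
    obtain rfl := (Finset.mem_filter.1 he).2
    have h2 := hf e.symm
    rw [SimpleGraph.Dart.symm_symm] at h2
    rw [hf e, show e.snd = e.symm.fst from rfl, h2]
    field_simp
    ring
  rw [Finset.sum_congr rfl h1, Finset.sum_add_distrib, sum_darts_const, ← Finset.mul_sum]
  show _ + (z - z⁻¹) * inSum G f x = (z + ((G.degree x : ℂ) - 1) * z⁻¹) * inSum G f x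
  ring

/-- The 1 + q(x) edges into x contribute −(1 + q)z⁻¹, which reduces the factor z + z⁻¹q of the
neighbor sum to z − z⁻¹. -/
theorem inSum_gradient {z : ℂ} {φ : V → ℂ}
    (hφ : φ ∈ LinearMap.eqLocus (neighborSum G) (rescale G z)) (x : V) :
    inSum G (gradient G z φ) x = (z - z⁻¹) * φ x := by
  rw [LinearMap.mem_eqLocus] at hφ
  have h1 := congrFun hφ x
  rw [neighborSum_eq_sum_darts] at h1
  have h2 : inSum G (gradient G z φ) x =
      ∑ e : G.Dart with e.snd = x, (φ e.fst - z⁻¹ * φ x) := by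
    refine Finset.sum_congr rfl fun e he => ?_
    obtain rfl := (Finset.mem_filter.1 he).2
    rfl
  rw [h2, Finset.sum_sub_distrib, h1, sum_darts_const]
  show (z + ((G.degree x : ℂ) - 1) * z⁻¹) * φ x - _ = _
  ring

theorem smul_gradient_mem {z : ℂ} (hz : z ≠ 0) {φ : V → ℂ}
    (hφ : φ ∈ LinearMap.eqLocus (neighborSum G) (rescale G z)) :
    (z - z⁻¹)⁻¹ • gradient G z φ ∈ Module.End.eigenspace (turnSum G) z := by
  refine Submodule.smul_mem _ _ (mem_eigenspace_turnSum.2 fun e => ?_)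
  rw [inSum_gradient hφ]
  show _ = z * (φ e.fst - z⁻¹ * φ e.snd) + (φ e.snd - z⁻¹ * φ e.fst)
  field_simp
  ring

variable (G) in
/-- Summation over incoming edges identifies the eigenfunctions of the turn sum operator with the
equalizer of the neighbor sum and the rescaling operator. -/
noncomputable def inSumEquiv {z : ℂ} (hz : z ≠ 0) (hz' : z - z⁻¹ ≠ 0) :
    Module.End.eigenspace (turnSum G) z ≃ₗ[ℂ]
      LinearMap.eqLocus (neighborSum G) (rescale G z) where
  toFun f := ⟨inSum G f.1, inSum_mem hz f.2⟩
  map_add' f g := Subtype.ext ((inSum G).map_add _ _)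
  map_smul' a f := Subtype.ext ((inSum G).map_smul _ _)
  invFun φ := ⟨(z - z⁻¹)⁻¹ • gradient G z φ.1, smul_gradient_mem hz φ.2⟩
  left_inv f := by
    refine Subtype.ext (funext fun e => ?_)
    have h1 := mem_eigenspace_turnSum.1 f.2 e
    have h2 := mem_eigenspace_turnSum.1 f.2 e.symm
    rw [SimpleGraph.Dart.symm_symm] at h2
    show (z - z⁻¹)⁻¹ * (inSum G f.1 e.fst - z⁻¹ * inSum G f.1 e.symm.fst) = f.1 e
    rw [h1, h2, inv_mul_eq_iff_eq_mul₀ hz']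
    field_simp
    ring
  right_inv φ := by
    refine Subtype.ext (funext fun x => ?_)
    show inSum G ((z - z⁻¹)⁻¹ • gradient G z φ.1) x = φ.1 x
    rw [map_smul, Pi.smul_apply, inSum_gradient φ.2, smul_eq_mul, inv_mul_cancel_left₀ hz']

end LocalOperators

end GraphSpectral

namespace GraphSpectral

/-! ### Finitely additive measures: integrals, point masses and limits -/

section Measures

open TopologicalSpace (Clopens)

variable {X : Type*} [TopologicalSpace X]

theorem charFn_apply_of_mem {A : Clopens X} {x : X} (h : x ∈ A) : charFn A x = 1 :=
  Set.indicator_of_mem (s := (A : Set X)) h (1 : X → ℂ)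

theorem charFn_apply_of_notMem {A : Clopens X} {x : X} (h : x ∉ A) : charFn A x = 0 :=
  Set.indicator_of_notMem (s := (A : Set X)) h (1 : X → ℂ)

theorem integral_charFn (μ : FAMeasure X) (A : Clopens X) : integral μ (charFn A) = μ A := by
  unfold integral
  rw [finsum_eq_single _ 1]
  · rw [one_mul]
    refine congrArg μ.1 (SetLike.ext fun x => ?_)
    show charFn A x = 1 ↔ x ∈ A
    by_cases hx : x ∈ A
    · simp [charFn_apply_of_mem hx, hx]
    · simp [charFn_apply_of_notMem hx, hx]
  · intro c hc
    by_cases h0 : c = 0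
    · simp [h0]
    · rw [fiber_eq_bot, measure_bot, mul_zero]
      rintro ⟨x, rfl⟩
      by_cases hx : x ∈ A
      · exact hc (charFn_apply_of_mem hx)
      · exact h0 (charFn_apply_of_notMem hx)

theorem integral_smul (μ : FAMeasure X) (a : ℂ) (f : LocallyConstant X ℂ)
    (hf : (Set.range f).Finite) : integral μ (a • f) = a * integral μ f := by
  rw [show a • f = f.map (fun c => a * c) from rfl, integral_map μ f _ hf,
    integral_eq_sum μ f hf, Finset.mul_sum]
  exact Finset.sum_congr rfl fun c _ => mul_assoc _ _ _

/-- The point mass at `x`. -/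
noncomputable def dirac (x : X) : FAMeasure X :=
  ⟨fun A => charFn A x, fun A B h => by
    show charFn (A ⊔ B) x = _
    rw [charFn_sup A B h]
    rfl⟩

/-- Additivity involves three sets at a time, so eventual constancy on each set separately is
enough; no uniformity is needed. -/
theorem exists_limit_measure (u : ℕ → FAMeasure X)
    (h : ∀ A, ∃ a, ∀ᶠ n in Filter.atTop, u n A = a) :
    ∃ μ : FAMeasure X, ∀ A, ∀ᶠ n in Filter.atTop, u n A = μ A := by
  choose a ha using h
  refine ⟨⟨a, fun A B hAB => ?_⟩, ha⟩
  obtain ⟨n, h1, h2, h3⟩ := ((ha (A ⊔ B)).and ((ha A).and (ha B))).exists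
  rw [← h1, ← h2, ← h3]
  exact (u n).2 A B hAB

theorem eventually_integral_eq {u : ℕ → FAMeasure X} {μ : FAMeasure X}
    (h : ∀ A, ∀ᶠ n in Filter.atTop, u n A = μ A) (f : LocallyConstant X ℂ)
    (hf : (Set.range f).Finite) :
    ∀ᶠ n in Filter.atTop, integral (u n) f = integral μ f := by
  filter_upwards [(Finset.eventually_all hf.toFinset).2 fun c _ => h (fiber f c)] with n hn
  rw [integral_eq_sum _ f hf, integral_eq_sum _ f hf]
  exact Finset.sum_congr rfl fun c hc => by rw [hn c hc]

end Measures

/-! ### Districts -/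

section Districts

open TopologicalSpace (Clopens)

variable {V : Type*} {G : SimpleGraph V}

theorem mem_district {w : List G.Dart} {p : PathSpace G} :
    p ∈ district w ↔ ∀ i (h : i < w.length), p i = w[i] :=
  ⟨fun h i hi => h ⟨i, hi⟩, fun h i => h i i.2⟩

theorem mem_district_cons {w : List G.Dart} {e : G.Dart} {p : PathSpace G} :
    p ∈ district (e :: w) ↔ p 0 = e ∧ p.drop 1 ∈ district w := by
  simp only [mem_district]
  constructor
  · intro h
    refine ⟨h 0 (by simp), fun i hi => ?_⟩
    have := h (i + 1) (by simpa using hi)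
    show p (1 + i) = _
    rw [add_comm]
    simpa using this
  · rintro ⟨h0, h⟩ i hi
    cases i with
    | zero => exact h0
    | succ i =>
      have : p (1 + i) = w[i]'(by simpa using hi) := h i (by simpa using hi)
      rw [add_comm] at this
      simpa using this

theorem mem_district_singleton {e : G.Dart} {p : PathSpace G} :
    p ∈ district [e] ↔ p 0 = e := by
  simp [mem_district]

theorem mem_district_concat {w : List G.Dart} {e : G.Dart} {p : PathSpace G} :
    p ∈ district (w ++ [e]) ↔ p ∈ district w ∧ p w.length = e := by
  simp only [mem_district]
  constructor
  · intro h
    refine ⟨fun i hi => ?_, ?_⟩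
    · rw [h i (by simp; omega), List.getElem_append_left hi]
    · rw [h w.length (by simp)]
      simp
  · rintro ⟨h, rfl⟩ i hi
    simp only [List.length_append, List.length_singleton] at hi
    by_cases hc : i < w.length
    · rw [h i hc, List.getElem_append_left hc]
    · obtain rfl : i = w.length := by omega
      simp

theorem mem_district_iff_map_range {w : List G.Dart} {p : PathSpace G} :
    p ∈ district w ↔ (List.range w.length).map p = w := by
  rw [mem_district]
  constructor
  · intro h
    refine List.ext_getElem (by simp) fun i _ hi => ?_
    simpa using h i hi
  · intro h i hi
    have := List.getElem_of_eq h (i := i) (by simpa using hi)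
    simpa using this

theorem isChain_of_mem_district {w : List G.Dart} {p : PathSpace G} (h : p ∈ district w) :
    w.IsChain Turn := by
  rw [List.isChain_iff_getElem]
  intro i hi
  rw [mem_district] at h
  rw [← h i (by omega), ← h (i + 1) (by omega)]
  exact p.2 i

theorem district_eq_bot {c : List G.Dart} (h : ¬ c.IsChain Turn) : district c = ⊥ :=
  le_bot_iff.1 fun _ hp => (h (isChain_of_mem_district hp)).elim

theorem clopens_disjoint_of_forall {X : Type*} [TopologicalSpace X] {A B : Clopens X}
    (h : ∀ x, x ∈ A → x ∉ B) : Disjoint A B :=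
  disjoint_iff_inf_le.2 fun x hx => h x hx.1 hx.2

theorem mem_finset_sup_clopens {X ι : Type*} [TopologicalSpace X] {s : Finset ι}
    {A : ι → Clopens X} {x : X} : x ∈ s.sup A ↔ ∃ i ∈ s, x ∈ A i := by
  classical
  induction s using Finset.induction_on with
  | empty =>
    simp only [Finset.sup_empty, Finset.notMem_empty, false_and, exists_false, iff_false]
    exact fun h => h
  | insert a s ha ih =>
    rw [Finset.sup_insert, show x ∈ A a ⊔ s.sup A ↔ x ∈ A a ∨ x ∈ s.sup A from Iff.rfl, ih]
    simp

theorem measure_district_eq_sum [Fintype G.Dart] (μ : FAMeasure (PathSpace G))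
    (c : List G.Dart) : μ (district c) = ∑ e : G.Dart, μ (district (c ++ [e])) := by
  rw [← measure_sup μ]
  · refine congrArg μ.1 (SetLike.ext fun p => ?_)
    rw [mem_finset_sup_clopens]
    simp [mem_district_concat]
  · intro e e' h
    refine clopens_disjoint_of_forall fun p hp hp' => h ?_
    rw [← (mem_district_concat.1 hp).2, ← (mem_district_concat.1 hp').2]

theorem exists_agree_subset {U : Set (PathSpace G)} (hU : IsOpen U) {p : PathSpace G}
    (hp : p ∈ U) : ∃ n, ∀ q : PathSpace G, (∀ i < n, p i = q i) → q ∈ U := by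
  obtain ⟨W, hW, hWU⟩ := isOpen_induced_iff.1 hU
  have hiff : ∀ q : PathSpace G, q ∈ U ↔ q.1 ∈ W := fun q => (Set.ext_iff.1 hWU q).symm
  obtain ⟨I, u, hu, hIu⟩ := isOpen_pi_iff.1 hW p.1 ((hiff p).1 hp)
  refine ⟨I.sup id + 1, fun q hq => (hiff q).2 (hIu fun i hi => ?_)⟩
  have h1 : i ≤ I.sup id := Finset.le_sup (f := id) hi
  rw [← hq i (by omega)]
  exact (hu i hi).2

/-- Compactness: the sets of paths whose first n edges already force membership in `A` are open,
increase with n and cover `A`. -/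
theorem exists_depth [Finite G.Dart] (A : Clopens (PathSpace G)) :
    ∃ N, ∀ p q : PathSpace G, (∀ i < N, p i = q i) → p ∈ A → q ∈ A := by
  let U : ℕ → Set (PathSpace G) := fun n =>
    {p | (∀ q : PathSpace G, (∀ i < n, p i = q i) → q ∈ A)}
  have hopen : ∀ n, IsOpen (U n) := by
    intro n
    rw [isOpen_iff_mem_nhds]
    intro p hp
    have h : ∀ᶠ r in 𝓝 p, ∀ i ∈ Finset.range n, r i = p i := by
      rw [Finset.eventually_all]
      intro i _
      exact (continuous_coord i).continuousAt.eventually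
        ((isOpen_discrete ({p i} : Set G.Dart)).mem_nhds rfl)
    filter_upwards [h] with r hr q hq
    exact hp q fun i hi => (hr i (Finset.mem_range.2 hi)).symm.trans (hq i hi)
  have hcover : (A : Set (PathSpace G)) ⊆ ⋃ n, U n := fun p hp =>
    Set.mem_iUnion.2 (exists_agree_subset A.isClopen.isOpen hp)
  have hdir : Directed (· ⊆ ·) U :=
    directed_of_isDirected_le fun m n hmn p hp q hq => hp q fun i hi => hq i (by omega)
  obtain ⟨N, hN⟩ := A.isClopen.isClosed.isCompact.elim_directed_cover U hopen hcover hdir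
  exact ⟨N, fun p q hpq hp => hN hp q hpq⟩

/-- A clopen set of paths is a finite disjoint union of districts of any large enough depth. -/
theorem exists_eq_sup_district [Finite G.Dart] (A : Clopens (PathSpace G)) (M : ℕ) :
    ∃ N ≥ M, ∃ s : Finset (Fin N → G.Dart), A = s.sup fun c => district (List.ofFn c) := by
  classical
  obtain ⟨N, hN⟩ := exists_depth A
  have := Fintype.ofFinite G.Dart
  -- Membership in `A` is decided by `N` edges, hence also by any larger number; all districts of
  -- that depth inside `A` are taken.
  refine ⟨max M N, le_max_left _ _,
    Finset.univ.filter fun c => district (List.ofFn c) ≤ A, SetLike.ext fun p => ?_⟩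
  rw [mem_finset_sup_clopens]
  constructor
  · intro hp
    refine ⟨fun i => p i, ?_, ?_⟩
    · refine Finset.mem_filter.2 ⟨Finset.mem_univ _, fun q hq => hN p q (fun i hi => ?_) hp⟩
      have := mem_district.1 hq i (by simp; omega)
      simpa using this.symm
    · rw [mem_district]
      intro i hi
      simp
  · rintro ⟨c, hc, hp⟩
    exact (Finset.mem_filter.1 hc).2 hp

theorem measure_sup_district {N : ℕ} (μ : FAMeasure (PathSpace G))
    (s : Finset (Fin N → G.Dart)) :
    μ (s.sup fun c => district (List.ofFn c)) = ∑ c ∈ s, μ (district (List.ofFn c)) := by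
  refine measure_sup μ s _ fun c d hcd => clopens_disjoint_of_forall fun p hp hp' => hcd ?_
  funext i
  have h1 := mem_district.1 hp i (by simp)
  have h2 := mem_district.1 hp' i (by simp)
  simpa using h1.symm.trans h2

/-- A measure is determined by its values on deep districts. -/
theorem measure_ext_of_district [Finite G.Dart] {μ ν : FAMeasure (PathSpace G)} (M : ℕ)
    (h : ∀ c : List G.Dart, M ≤ c.length → c.IsChain Turn → μ (district c) = ν (district c)) :
    μ = ν := by
  refine Subtype.ext (funext fun A => ?_)
  obtain ⟨N, hN, s, rfl⟩ := exists_eq_sup_district A M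
  rw [measure_sup_district, measure_sup_district]
  refine Finset.sum_congr rfl fun c _ => ?_
  by_cases hc : (List.ofFn c).IsChain Turn
  · exact h _ (by simpa using hN) hc
  · rw [district_eq_bot hc, measure_bot, measure_bot]

end Districts

/-! ### Eigenmeasures of the dual transfer operator -/

section Eigenmeasures

open TopologicalSpace (Clopens)

variable {V : Type*} [Fintype V] {G : SimpleGraph V} [DecidableRel G.Adj]

/-- A vertex of degree at least 2 has a neighbor other than the one the edge came from. -/
theorem exists_turn (hdeg : ∀ v, 2 ≤ G.degree v) (e : G.Dart) : ∃ e' : G.Dart, Turn e e' := by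
  have h : 1 < (G.neighborFinset e.snd).card := by
    rw [SimpleGraph.card_neighborFinset_eq_degree]
    exact hdeg e.snd
  obtain ⟨y, hy, hne⟩ := Finset.exists_mem_ne h e.fst
  refine ⟨⟨(e.snd, y), (G.mem_neighborFinset _ _).1 hy⟩, rfl, fun h => hne ?_⟩
  exact (congrArg (fun d => d.fst) h).symm

theorem exists_path (hdeg : ∀ v, 2 ≤ G.degree v) (e : G.Dart) :
    ∃ p : PathSpace G, p 0 = e := by
  choose next hnext using exists_turn hdeg
  refine ⟨⟨fun n => next^[n] e, fun n => ?_⟩, rfl⟩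
  show Turn (next^[n] e) (next^[n + 1] e)
  rw [Function.iterate_succ_apply']
  exact hnext _

variable [DecidableEq V]

/-- Among the prolongations of `p` by one edge in front, only the one by `e` can lie in the
district. -/
theorem transfer_charFn_cons (e : G.Dart) (c : List G.Dart) (p : PathSpace G) :
    transferLC G (charFn (district (e :: c))) p =
      if Turn e (p 0) then charFn (district c) p else 0 := by
  show ∑ e' : G.Dart, (if h : Turn e' (p 0) then
    charFn (district (e :: c)) (p.cons e' h) else 0) = _
  rw [Finset.sum_eq_single e]
  · by_cases h : Turn e (p 0)
    · rw [dif_pos h, if_pos h]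
      have hd : (p.cons e h).drop 1 = p := by
        refine Subtype.ext (funext fun n => ?_)
        show (p.cons e h) (1 + n) = p n
        rw [add_comm]
        rfl
      have hiff : p.cons e h ∈ district (e :: c) ↔ p ∈ district c := by
        rw [mem_district_cons, hd]
        exact and_iff_right rfl
      by_cases hp : p ∈ district c
      · rw [charFn_apply_of_mem hp, charFn_apply_of_mem (hiff.2 hp)]
      · rw [charFn_apply_of_notMem hp, charFn_apply_of_notMem (mt hiff.1 hp)]
    · rw [dif_neg h, if_neg h]
  · intro e' _ hne
    split_ifs with h
    · refine charFn_apply_of_notMem fun hmem => hne ?_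
      exact (mem_district_cons.1 hmem).1
    · rfl
  · simp

theorem dualTransfer_district_cons_cons (μ : FAMeasure (PathSpace G)) {e e' : G.Dart}
    (h : Turn e e') (c : List G.Dart) :
    dualTransfer G μ (district (e :: e' :: c)) = μ (district (e' :: c)) := by
  rw [← integral_charFn μ]
  refine congrArg (integral μ) (LocallyConstant.ext fun p => ?_)
  rw [transfer_charFn_cons]
  split_ifs with hp
  · rfl
  · refine (charFn_apply_of_notMem fun hmem => hp ?_).symm
    rw [(mem_district_cons.1 hmem).1]
    exact h

theorem dualTransfer_district_singleton (μ : FAMeasure (PathSpace G)) (e : G.Dart) :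
    dualTransfer G μ (district [e]) = ∑ e' : G.Dart with Turn e e', μ (district [e']) := by
  rw [← measure_sup μ, ← integral_charFn μ]
  · refine congrArg (integral μ) (LocallyConstant.ext fun p => ?_)
    rw [transfer_charFn_cons]
    split_ifs with hp
    · rw [charFn_apply_of_mem, charFn_apply_of_mem]
      · exact mem_finset_sup_clopens.2 ⟨p 0, by simpa using hp, mem_district_singleton.2 rfl⟩
      · simp [mem_district]
    · refine (charFn_apply_of_notMem fun hmem => hp ?_).symm
      obtain ⟨e', he', hpe⟩ := mem_finset_sup_clopens.1 hmem
      rw [mem_district_singleton.1 hpe]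
      simpa using he'
  · intro d d' hne
    refine clopens_disjoint_of_forall fun p hp hq => hne ?_
    rw [← mem_district_singleton.1 hp, ← mem_district_singleton.1 hq]

/-- The function `e ↦ μ(P_ē)` on the oriented edges. -/
noncomputable def edgeMass : FAMeasure (PathSpace G) →ₗ[ℂ] (G.Dart → ℂ) where
  toFun μ e := μ (district [e.symm])
  map_add' _ _ := rfl
  map_smul' _ _ := rfl

/-- Reversing edges exchanges successors and predecessors. The intertwining holds for every measure,
not only for eigenmeasures, which is what the iteration below needs. -/
theorem edgeMass_dualTransfer (μ : FAMeasure (PathSpace G)) :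
    edgeMass (dualTransfer G μ) = turnSum G (edgeMass μ) := by
  ext e
  show dualTransfer G μ (district [e.symm]) = ∑ e' : G.Dart with Turn e' e, μ (district [e'.symm])
  rw [dualTransfer_district_singleton]
  refine Finset.sum_nbij' SimpleGraph.Dart.symm SimpleGraph.Dart.symm ?_ ?_ ?_ ?_ ?_
  · intro e' he'
    have h := (Finset.mem_filter.1 he').2
    rw [← turn_symm_iff, SimpleGraph.Dart.symm_symm] at h
    simpa using h
  · intro e' he'
    have h := (Finset.mem_filter.1 he').2
    rw [← turn_symm_iff] at h
    simpa using h
  · intro _ _; simp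
  · intro _ _; simp
  · intro _ _; simp

theorem edgeMass_mem {z : ℂ} {μ : FAMeasure (PathSpace G)}
    (h : μ ∈ Module.End.eigenspace (dualTransfer G) z) :
    edgeMass μ ∈ Module.End.eigenspace (turnSum G) z := by
  rw [Module.End.mem_eigenspace_iff] at h ⊢
  rw [← edgeMass_dualTransfer, h, map_smul]

/-- Dropping the first edge costs a factor z⁻¹ each time, until only the last edge is left. -/
theorem eigenmeasure_district {z : ℂ} (hz : z ≠ 0) {μ : FAMeasure (PathSpace G)}
    (hμ : μ ∈ Module.End.eigenspace (dualTransfer G) z) (c : List G.Dart) (e : G.Dart)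
    (hc : (c ++ [e]).IsChain Turn) :
    μ (district (c ++ [e])) = z ^ (-(c.length : ℤ)) * edgeMass μ e.symm := by
  rw [Module.End.mem_eigenspace_iff] at hμ
  induction c with
  | nil => simp [edgeMass]
  | cons d c ih =>
    obtain ⟨d', c', hdc⟩ : ∃ d' c', c ++ [e] = d' :: c' := by
      cases c with
      | nil => exact ⟨_, _, rfl⟩
      | cons d' c' => exact ⟨_, _, rfl⟩
    have hc' := hc
    rw [List.cons_append, hdc, List.isChain_cons_cons] at hc'
    have h1 : dualTransfer G μ (district (d :: (c ++ [e]))) = z * μ (district (d :: (c ++ [e]))) := by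
      rw [hμ]
      rfl
    rw [hdc, dualTransfer_district_cons_cons μ hc'.1, ← hdc, ih (hdc ▸ hc'.2)] at h1
    rw [List.cons_append, ← inv_mul_eq_iff_eq_mul₀ hz |>.2 h1, List.length_cons, Nat.cast_succ,
      neg_add, zpow_add₀ hz, zpow_neg_one]
    ring

theorem edgeMass_injOn {z : ℂ} (hz : z ≠ 0) {μ ν : FAMeasure (PathSpace G)}
    (hμ : μ ∈ Module.End.eigenspace (dualTransfer G) z)
    (hν : ν ∈ Module.End.eigenspace (dualTransfer G) z) (h : edgeMass μ = edgeMass ν) :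
    μ = ν := by
  refine measure_ext_of_district 1 fun c hl hc => ?_
  have hne : c ≠ [] := List.ne_nil_of_length_pos hl
  rw [← List.dropLast_append_getLast hne] at hc ⊢
  rw [eigenmeasure_district hz hμ _ _ hc, eigenmeasure_district hz hν _ _ hc, h]

/-- Successive approximations of an eigenmeasure, starting with point masses. -/
noncomputable def approxMeasure (z : ℂ) (μ : FAMeasure (PathSpace G)) (n : ℕ) :
    FAMeasure (PathSpace G) := ((z⁻¹ • dualTransfer G) ^ n) μ

theorem approxMeasure_succ (z : ℂ) (μ : FAMeasure (PathSpace G)) (n : ℕ) :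
    approxMeasure z μ (n + 1) = z⁻¹ • dualTransfer G (approxMeasure z μ n) := by
  unfold approxMeasure
  rw [pow_succ', Module.End.mul_apply]
  rfl

theorem edgeMass_approxMeasure {z : ℂ} (hz : z ≠ 0) {μ : FAMeasure (PathSpace G)}
    (h : edgeMass μ ∈ Module.End.eigenspace (turnSum G) z) (n : ℕ) :
    edgeMass (approxMeasure z μ n) = edgeMass μ := by
  induction n with
  | zero => rfl
  | succ n ih =>
    rw [approxMeasure_succ, map_smul, edgeMass_dualTransfer, ih,
      Module.End.mem_eigenspace_iff.1 h, inv_smul_smul₀ hz]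

/-- Each application of z⁻¹L' trades the district for one shorter by an edge. After `c.length` steps
a single edge remains, whose mass never changes. -/
theorem approxMeasure_district_const {z : ℂ} (hz : z ≠ 0) {μ : FAMeasure (PathSpace G)}
    (h : edgeMass μ ∈ Module.End.eigenspace (turnSum G) z) (e : G.Dart) (c : List G.Dart)
    (n : ℕ) : approxMeasure z μ (c.length + n) (district (e :: c)) =
      approxMeasure z μ c.length (district (e :: c)) := by
  induction c generalizing e with
  | nil =>
    have h1 := congrFun (edgeMass_approxMeasure hz h n) e.symm
    have h2 : (approxMeasure z μ n) (district [e.symm.symm]) = μ (district [e.symm.symm]) := h1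
    rw [SimpleGraph.Dart.symm_symm] at h2
    simpa [approxMeasure] using h2
  | cons d c ih =>
    by_cases hed : Turn e d
    · rw [List.length_cons, add_right_comm, approxMeasure_succ, approxMeasure_succ]
      show z⁻¹ * dualTransfer G _ (district (e :: d :: c)) =
        z⁻¹ * dualTransfer G _ (district (e :: d :: c))
      rw [dualTransfer_district_cons_cons _ hed, dualTransfer_district_cons_cons _ hed, ih]
    · have hbot : district (e :: d :: c) = ⊥ :=
        district_eq_bot fun hc => hed (List.isChain_cons_cons.1 hc).1
      rw [hbot, measure_bot, measure_bot]

theorem eventually_approxMeasure {z : ℂ} (hz : z ≠ 0) {μ : FAMeasure (PathSpace G)}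
    (h : edgeMass μ ∈ Module.End.eigenspace (turnSum G) z) (A : Clopens (PathSpace G)) :
    ∃ a, ∀ᶠ n in Filter.atTop, approxMeasure z μ n A = a := by
  -- Depth at least 1 excludes the empty sequence, for which no stabilization has been shown.
  obtain ⟨N, hN, s, rfl⟩ := exists_eq_sup_district A 1
  refine ⟨approxMeasure z μ N (s.sup fun c => district (List.ofFn c)), ?_⟩
  filter_upwards [Filter.eventually_ge_atTop N] with n hn
  rw [measure_sup_district, measure_sup_district]
  refine Finset.sum_congr rfl fun c _ => ?_
  obtain ⟨e, d, hed⟩ : ∃ e d, List.ofFn c = e :: d :=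
    List.exists_cons_of_ne_nil (List.ne_nil_of_length_pos (by rw [List.length_ofFn]; omega))
  have hl : N = d.length + 1 := by rw [← List.length_ofFn (f := c), hed, List.length_cons]
  obtain ⟨k, rfl⟩ := Nat.exists_eq_add_of_le hn
  rw [hed, hl, show d.length + 1 + k = d.length + (1 + k) by ring,
    approxMeasure_district_const hz h, approxMeasure_district_const hz h]

/-- The limit of the iterates is a fixed point of z⁻¹L' because, for each clopen set, finitely many
level sets decide the integral and all of them stabilize. -/
theorem exists_eigenmeasure {z : ℂ} (hz : z ≠ 0) (hdeg : ∀ v, 2 ≤ G.degree v) {f : G.Dart → ℂ}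
    (hf : f ∈ Module.End.eigenspace (turnSum G) z) :
    ∃ μ ∈ Module.End.eigenspace (dualTransfer G) z, edgeMass μ = f := by
  choose path hpath using exists_path (G := G) hdeg
  -- One point mass per edge, on an arbitrary path starting with it; the weights only have to give
  -- the prescribed edge masses.
  let μ₀ : FAMeasure (PathSpace G) := ∑ e : G.Dart, f e.symm • dirac (path e)
  have hμ₀ : edgeMass μ₀ = f := by
    simp only [μ₀, map_sum, map_smul]
    ext e
    rw [Finset.sum_apply, Finset.sum_eq_single e.symm]
    · show f e.symm.symm * charFn (district [e.symm]) (path e.symm) = f e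
      rw [charFn_apply_of_mem (mem_district_singleton.2 (hpath _)), mul_one,
        SimpleGraph.Dart.symm_symm]
    · intro d _ hd
      show f d.symm * charFn (district [e.symm]) (path d) = 0
      rw [charFn_apply_of_notMem fun hmem => hd ?_, mul_zero]
      rw [← hpath d]
      exact mem_district_singleton.1 hmem
    · simp
  have hμ₀' : edgeMass μ₀ ∈ Module.End.eigenspace (turnSum G) z := hμ₀ ▸ hf
  obtain ⟨μ, hμ⟩ := exists_limit_measure (approxMeasure z μ₀)
    (eventually_approxMeasure hz hμ₀')
  refine ⟨μ, ?_, ?_⟩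
  · rw [Module.End.mem_eigenspace_iff]
    refine Subtype.ext (funext fun A => ?_)
    -- A single n at which the integral against iterate n and the value of iterate n + 1 on `A` have
    -- both reached their limits.
    obtain ⟨n, h1, h2⟩ := ((eventually_integral_eq hμ (transferLC G (charFn A))
      (LocallyConstant.range_finite _)).and
        ((Filter.tendsto_add_atTop_nat 1).eventually (hμ A))).exists
    show integral μ (transferLC G (charFn A)) = z * μ A
    rw [← h1, ← h2, approxMeasure_succ]
    show _ = z * (z⁻¹ * integral _ (transferLC G (charFn A)))
    rw [mul_inv_cancel_left₀ hz]
  · ext e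
    obtain ⟨n, hn⟩ := (hμ (district [e.symm])).exists
    show μ (district [e.symm]) = f e
    rw [← hn]
    show edgeMass (approxMeasure z μ₀ n) e = f e
    rw [edgeMass_approxMeasure hz hμ₀', hμ₀]

variable (G) in
/-- Eigenmeasures of the dual transfer operator correspond to eigenfunctions of the turn sum. -/
noncomputable def edgeMassEquiv {z : ℂ} (hz : z ≠ 0) (hdeg : ∀ v, 2 ≤ G.degree v) :
    Module.End.eigenspace (dualTransfer G) z ≃ₗ[ℂ] Module.End.eigenspace (turnSum G) z :=
  LinearEquiv.ofBijective (edgeMass.restrict fun _ => edgeMass_mem) (by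
    constructor
    · intro μ ν h
      exact Subtype.ext (edgeMass_injOn hz μ.2 ν.2 (congrArg Subtype.val h))
    · intro f
      obtain ⟨μ, hμ, h⟩ := exists_eigenmeasure hz hdeg f.2
      exact ⟨⟨μ, hμ⟩, Subtype.ext h⟩)

end Eigenmeasures

end GraphSpectral

namespace GraphSpectral

/-! ### Lifting walks to the universal cover -/

section Lifting

variable {V : Type*} {G : SimpleGraph V} {o : V}

/-- The list `w` consists of the successive edges of a walk that starts at `x`. -/
def IsWalkFrom : V → List G.Dart → Prop
  | _, [] => True
  | x, e :: w => e.fst = x ∧ IsWalkFrom e.snd w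

/-- The end point of a walk that starts at `x`. -/
def walkEnd : V → List G.Dart → V
  | x, [] => x
  | _, e :: w => walkEnd e.snd w

/-- The edges of a walk traversed backwards. -/
def reverseDarts (w : List G.Dart) : List G.Dart := w.reverse.map SimpleGraph.Dart.symm

theorem reverseDarts_cons (e : G.Dart) (w : List G.Dart) :
    reverseDarts (e :: w) = reverseDarts w ++ [e.symm] := by
  simp [reverseDarts]

theorem reverseDarts_reverseDarts (w : List G.Dart) : reverseDarts (reverseDarts w) = w := by
  simp [reverseDarts, List.map_reverse]

theorem isWalkFrom_append {x : V} {w w' : List G.Dart} :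
    IsWalkFrom x (w ++ w') ↔ IsWalkFrom x w ∧ IsWalkFrom (walkEnd x w) w' := by
  induction w generalizing x with
  | nil => simp [IsWalkFrom, walkEnd]
  | cons e w ih => simp [IsWalkFrom, walkEnd, ih, and_assoc]

theorem walkEnd_append (x : V) (w w' : List G.Dart) :
    walkEnd x (w ++ w') = walkEnd (walkEnd x w) w' := by
  induction w generalizing x with
  | nil => rfl
  | cons e w ih => exact ih _

theorem IsWalkFrom.reverseDarts {x : V} {w : List G.Dart} (h : IsWalkFrom x w) :
    IsWalkFrom (walkEnd x w) (reverseDarts w) ∧ walkEnd (walkEnd x w) (reverseDarts w) = x := by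
  induction w generalizing x with
  | nil => exact ⟨trivial, rfl⟩
  | cons e w ih =>
    obtain ⟨h1, h2⟩ := ih h.2
    rw [reverseDarts_cons, isWalkFrom_append, walkEnd_append]
    refine ⟨⟨h1, ?_⟩, h.1⟩
    show IsWalkFrom (walkEnd (walkEnd e.snd w) _) [e.symm]
    rw [h2]
    exact ⟨rfl, trivial⟩

theorem coverProj_eq_walkEnd (c : CoverVertex G o) : coverProj c = walkEnd o c.1 := by
  have h : ∀ (w : List G.Dart) (x : V), w.getLast?.elim x (fun e => e.snd) = walkEnd x w := by
    intro w
    induction w with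
    | nil => intro x; rfl
    | cons e w ih =>
      intro x
      rw [List.getLast?_cons, show walkEnd x (e :: w) = walkEnd e.snd w from rfl, ← ih]
      cases w.getLast? <;> rfl
  exact h c.1 o

theorem isWalkFrom_cover (c : CoverVertex G o) : IsWalkFrom o c.1 := by
  have h : ∀ (w : List G.Dart) (x : V), w.IsChain Turn → (∀ e ∈ w.head?, e.fst = x) →
      IsWalkFrom x w := by
    intro w
    induction w with
    | nil => intros; trivial
    | cons e w ih =>
      intro x hw hx
      refine ⟨hx e rfl, ih _ hw.of_cons fun e' he' => ?_⟩
      obtain ⟨w', rfl⟩ := List.head?_eq_some_iff.1 (Option.mem_def.1 he')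
      exact (List.isChain_cons_cons.1 hw).1.1.symm
  exact h c.1 o c.2.1 c.2.2

theorem coverProj_of_eq_concat {d : CoverVertex G o} {l : List G.Dart} {e : G.Dart}
    (h : d.1 = l ++ [e]) : coverProj d = e.snd := by
  rw [coverProj_eq_walkEnd, h, walkEnd_append]
  rfl

theorem fst_of_eq_concat {c d : CoverVertex G o} {e : G.Dart} (h : d.1 = c.1 ++ [e]) :
    e.fst = coverProj c := by
  have h1 := isWalkFrom_cover d
  rw [h, isWalkFrom_append, ← coverProj_eq_walkEnd] at h1
  exact h1.2.1

theorem getLast?_ne_of_eq_concat {c d : CoverVertex G o} {e : G.Dart} (h : d.1 = c.1 ++ [e]) :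
    c.1.getLast? ≠ some e.symm := by
  intro hl
  have h1 := d.2.1
  rw [h, List.isChain_append] at h1
  exact (h1.2.2 e.symm hl e rfl).2 rfl

theorem exists_concat {c : CoverVertex G o} {e : G.Dart} (he : e.fst = coverProj c)
    (hl : c.1.getLast? ≠ some e.symm) : ∃ d : CoverVertex G o, d.1 = c.1 ++ [e] := by
  refine ⟨⟨c.1 ++ [e], ?_, ?_⟩, rfl⟩
  · refine List.isChain_append.2 ⟨c.2.1, List.isChain_singleton e, fun x hx y hy => ?_⟩
    obtain rfl : e = y := by simpa using hy
    refine ⟨?_, ?_⟩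
    · rw [he, coverProj, Option.mem_def.1 hx]
      rfl
    · rintro rfl
      exact hl hx
  · intro x hx
    by_cases hc : c.1 = []
    · obtain rfl : e = x := by simpa [hc] using hx
      rw [he, coverProj, hc]
      rfl
    · rw [List.head?_append_of_ne_nil _ hc] at hx
      exact c.2.2 x hx

theorem exists_eq_concat {c : CoverVertex G o} {e : G.Dart} (h : c.1.getLast? = some e) :
    ∃ d : CoverVertex G o, c.1 = d.1 ++ [e] := by
  obtain ⟨l, hl⟩ := List.getLast?_eq_some_iff.1 h
  have h1 := c.2
  rw [hl] at h1
  refine ⟨⟨l, h1.1.left_of_append, fun x hx => h1.2 x ?_⟩, hl⟩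
  rw [List.head?_append, Option.mem_def.1 hx]
  rfl

/-- Unique lifting of edges: if the path ends with ē the lift cancels that edge, otherwise it
appends e, and the two cases exclude each other. -/
theorem existsUnique_step (c : CoverVertex G o) {e : G.Dart} (he : e.fst = coverProj c) :
    ∃! d : CoverVertex G o, d.1 = c.1 ++ [e] ∨ c.1 = d.1 ++ [e.symm] := by
  by_cases hl : c.1.getLast? = some e.symm
  · obtain ⟨d, hd⟩ := exists_eq_concat hl
    refine ⟨d, Or.inr hd, ?_⟩
    rintro d' (h | h)
    · exact (getLast?_ne_of_eq_concat h hl).elim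
    · exact Subtype.ext (List.append_cancel_right (h.symm.trans hd))
  · obtain ⟨d, hd⟩ := exists_concat he hl
    refine ⟨d, Or.inl hd, ?_⟩
    rintro d' (h | h)
    · exact Subtype.ext (h.trans hd.symm)
    · exact (hl (by rw [h]; simp)).elim

open Classical in
/-- The vertex of the universal cover that is reached from `c` along the lift of the edge `e`
(and `c` itself if `e` does not start at the projection of `c`). -/
noncomputable def step (c : CoverVertex G o) (e : G.Dart) : CoverVertex G o :=
  if he : e.fst = coverProj c then (existsUnique_step c he).choose else c

theorem step_spec {c : CoverVertex G o} {e : G.Dart} (he : e.fst = coverProj c) :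
    (step c e).1 = c.1 ++ [e] ∨ c.1 = (step c e).1 ++ [e.symm] := by
  rw [step, dif_pos he]
  exact (existsUnique_step c he).choose_spec.1

theorem eq_step {c d : CoverVertex G o} {e : G.Dart}
    (h : d.1 = c.1 ++ [e] ∨ c.1 = d.1 ++ [e.symm]) : d = step c e := by
  have he : e.fst = coverProj c := by
    rcases h with h | h
    · exact fst_of_eq_concat h
    · exact (coverProj_of_eq_concat h).symm
  exact (existsUnique_step c he).unique h (step_spec he)

theorem coverProj_step {c : CoverVertex G o} {e : G.Dart} (he : e.fst = coverProj c) :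
    coverProj (step c e) = e.snd := by
  rcases step_spec he with h | h
  · exact coverProj_of_eq_concat h
  · exact (fst_of_eq_concat h).symm

theorem step_step_symm {c : CoverVertex G o} {e : G.Dart} (he : e.fst = coverProj c) :
    step (step c e) e.symm = c := by
  refine (eq_step ?_).symm
  rw [SimpleGraph.Dart.symm_symm]
  exact (step_spec he).symm

theorem adj_iff_exists_step {c d : CoverVertex G o} :
    (cover G o).Adj c d ↔ ∃ e : G.Dart, e.fst = coverProj c ∧ d = step c e := by
  constructor
  · rintro (⟨e, h⟩ | ⟨e, h⟩)
    · exact ⟨e, fst_of_eq_concat h, eq_step (Or.inl h)⟩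
    · exact ⟨e.symm, (coverProj_of_eq_concat h).symm, eq_step (Or.inr (by simpa using h))⟩
  · rintro ⟨e, he, rfl⟩
    rcases step_spec he with h | h
    · exact Or.inl ⟨_, h⟩
    · exact Or.inr ⟨_, h⟩

/-- The vertex that is reached from `c` along the lift of the walk `w`. -/
noncomputable def follow (c : CoverVertex G o) (w : List G.Dart) : CoverVertex G o :=
  w.foldl step c

theorem follow_append (c : CoverVertex G o) (w w' : List G.Dart) :
    follow c (w ++ w') = follow (follow c w) w' :=
  List.foldl_append

theorem coverProj_follow {c : CoverVertex G o} {w : List G.Dart}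
    (h : IsWalkFrom (coverProj c) w) : coverProj (follow c w) = walkEnd (coverProj c) w := by
  induction w generalizing c with
  | nil => rfl
  | cons e w ih =>
    have h1 := coverProj_step h.1
    show coverProj (follow (step c e) w) = walkEnd e.snd w
    rw [ih (h1 ▸ h.2), h1]

theorem follow_reverseDarts {c : CoverVertex G o} {w : List G.Dart}
    (h : IsWalkFrom (coverProj c) w) : follow (follow c w) (reverseDarts w) = c := by
  induction w generalizing c with
  | nil => rfl
  | cons e w ih =>
    have h1 := coverProj_step h.1
    rw [reverseDarts_cons, follow_append, show follow c (e :: w) = follow (step c e) w from rfl,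
      ih (h1 ▸ h.2)]
    exact step_step_symm h.1

/-- No cancellation occurs along a path without backtracking, so from the empty path it lifts to the
chain of its own initial segments. -/
theorem follow_coverBase (c : CoverVertex G o) : follow coverBase c.1 = c := by
  have h : ∀ w : List G.Dart, ∀ c : CoverVertex G o, c.1 = w → follow coverBase w = c := by
    intro w
    induction w using List.reverseRecOn with
    | nil => exact fun c hc => Subtype.ext hc.symm
    | append_singleton w e ih =>
      intro c hc
      obtain ⟨d, hd⟩ := exists_eq_concat (c := c) (e := e) (by rw [hc]; simp)
      have hdw : d.1 = w := List.append_cancel_right (hd.symm.trans hc)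
      rw [follow_append, ih d hdw]
      exact (eq_step (Or.inl hd)).symm
  exact h c.1 c rfl

/-- Each step alters only the end of the path, removing at most one edge, so a short walk cannot
reach the first `k` edges. -/
theorem take_follow {c : CoverVertex G o} {w : List G.Dart} {k : ℕ}
    (h : IsWalkFrom (coverProj c) w) (hk : k + w.length ≤ c.1.length) :
    (follow c w).1.take k = c.1.take k := by
  induction w generalizing c with
  | nil => rfl
  | cons e w ih =>
    rw [List.length_cons] at hk
    show (follow (step c e) w).1.take k = _
    have h1 := coverProj_step h.1
    rcases step_spec h.1 with h2 | h2
    · rw [ih (h1 ▸ h.2) (by rw [h2, List.length_append]; omega), h2,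
        List.take_append_of_le_length (by omega)]
    · have hl := congrArg List.length h2
      rw [List.length_append, List.length_singleton] at hl
      rw [ih (h1 ▸ h.2) (by omega), h2, List.take_append_of_le_length (by omega)]

theorem isWalkFrom_darts {x y : V} (p : G.Walk x y) :
    IsWalkFrom x p.darts ∧ walkEnd x p.darts = y := by
  induction p with
  | nil => exact ⟨trivial, rfl⟩
  | cons h p ih => exact ⟨⟨rfl, ih.1⟩, ih.2⟩

theorem coverProj_surjective (hconn : G.Connected) :
    Function.Surjective (coverProj : CoverVertex G o → V) := by
  intro x
  obtain ⟨p⟩ := hconn.preconnected o x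
  have h := isWalkFrom_darts p
  exact ⟨follow coverBase p.darts, (coverProj_follow (c := coverBase) h.1).trans h.2⟩

/-- If all degrees are at least two, every oriented edge is the last edge of a path without
backtracking that starts at `o`. -/
theorem exists_cover_concat [Fintype V] [DecidableRel G.Adj] (hconn : G.Connected)
    (hdeg : ∀ v, 2 ≤ G.degree v) (o : V) (e : G.Dart) :
    ∃ c d : CoverVertex G o, d.1 = c.1 ++ [e] := by
  -- The path is built backwards: start with ē, continue without backtracking for longer than any
  -- chosen walk back to `o`, then follow such a walk. Cancellation cannot eat the first edge, so
  -- the reversed result ends with e.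
  obtain ⟨p, hp⟩ := exists_path hdeg e.symm
  have hwalk : ∀ x, Nonempty (G.Walk x o) := fun x => hconn.preconnected x o
  let walk : ∀ x, G.Walk x o := fun x => (hwalk x).some
  let N := Finset.univ.sup fun x => (walk x).length
  let p' : island G e.snd := ⟨p, by show (p 0).fst = _; rw [hp]; rfl⟩
  let a : CoverVertex G e.snd := initialSegment p' (N + 1)
  have ha : a.1.length = N + 1 := by simp [a, initialSegment]
  have hw := isWalkFrom_darts (walk (coverProj a))
  let b := follow a (walk (coverProj a)).darts
  have hb : coverProj b = o := (coverProj_follow hw.1).trans hw.2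
  have hlen : (walk (coverProj a)).length ≤ N :=
    Finset.le_sup (f := fun x => (walk x).length) (Finset.mem_univ _)
  have htake : b.1.take 1 = [e.symm] := by
    rw [take_follow hw.1 (by rw [SimpleGraph.Walk.length_darts]; omega)]
    simp [a, initialSegment, List.range_succ_eq_map, p', hp]
  obtain ⟨t, ht⟩ : ∃ t, b.1 = e.symm :: t :=
    ⟨b.1.drop 1, by rw [← List.singleton_append, ← htake, List.take_append_drop]⟩
  have hd : ∀ x ∈ (reverseDarts b.1).head?, x.fst = o := by
    intro x hx
    simp only [reverseDarts, List.head?_map, List.head?_reverse, Option.mem_def,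
      Option.map_eq_some_iff] at hx
    obtain ⟨y, hy, rfl⟩ := hx
    rw [← hb, coverProj, hy]
    rfl
  have hchain : (reverseDarts b.1).IsChain Turn := by
    rw [reverseDarts, List.isChain_map, List.isChain_reverse]
    exact b.2.1.imp fun x y h => turn_symm_iff.2 h
  let d : CoverVertex G o := ⟨reverseDarts b.1, hchain, hd⟩
  have hde : d.1 = reverseDarts t ++ [e] := by
    show reverseDarts b.1 = _
    rw [ht, reverseDarts_cons, SimpleGraph.Dart.symm_symm]
  obtain ⟨c, hc⟩ := exists_eq_concat (c := d) (e := e) (by rw [hde]; simp)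
  exact ⟨c, d, hc⟩

end Lifting

/-! ### Deck transformations -/

section Deck

variable {V : Type*} {G : SimpleGraph V} {o : V}

/-- For `x` over `o`, translating words to start at `x` is the candidate deck transformation. It
respects lifted edges, also when the step from `c` cancels; that case is read as the reverse step.
-/
theorem follow_step {x c : CoverVertex G o} (hx : coverProj x = o) {e : G.Dart}
    (he : e.fst = coverProj c) : follow x (step c e).1 = step (follow x c.1) e := by
  have hproj : ∀ d : CoverVertex G o, coverProj (follow x d.1) = coverProj d := by
    intro d
    rw [coverProj_follow (hx.symm ▸ isWalkFrom_cover d), hx, coverProj_eq_walkEnd]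
  rcases step_spec he with h | h
  · rw [h, follow_append]
    rfl
  · have h1 : follow x c.1 = step (follow x (step c e).1) e.symm := by
      rw [h, follow_append]
      rfl
    have h2 := step_step_symm (c := follow x (step c e).1) (e := e.symm)
      (by rw [hproj, coverProj_step he]; rfl)
    rw [h1]
    simpa using h2.symm

theorem follow_follow {x y : CoverVertex G o} (hx : coverProj x = o) {w : List G.Dart}
    (hw : IsWalkFrom (coverProj y) w) : follow x (follow y w).1 = follow (follow x y.1) w := by
  induction w generalizing y with
  | nil => rfl
  | cons e w ih =>
    show follow x (follow (step y e) w).1 = follow (step (follow x y.1) e) w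
    rw [ih (coverProj_step hw.1 ▸ hw.2), follow_step hx hw.1]

theorem adj_follow {x c d : CoverVertex G o} (hx : coverProj x = o)
    (h : (cover G o).Adj c d) : (cover G o).Adj (follow x c.1) (follow x d.1) := by
  obtain ⟨e, he, rfl⟩ := adj_iff_exists_step.1 h
  refine adj_iff_exists_step.2 ⟨e, ?_, follow_step hx he⟩
  rw [coverProj_follow (hx.symm ▸ isWalkFrom_cover c), hx, ← coverProj_eq_walkEnd, he]

theorem follow_inverse {x y : CoverVertex G o} (hx : coverProj x = o)
    (h : follow x y.1 = coverBase) (c : CoverVertex G o) (hy : coverProj y = o) :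
    follow x (follow y c.1).1 = c := by
  rw [follow_follow hx (hy.symm ▸ isWalkFrom_cover c), h, follow_coverBase]

theorem exists_deck_base {x : CoverVertex G o} (hx : coverProj x = o) :
    ∃ γ ∈ deckGroup G o, ∀ c, γ c = follow x c.1 := by
  have hw : IsWalkFrom o x.1 := isWalkFrom_cover x
  have hend : walkEnd o x.1 = o := by rw [← coverProj_eq_walkEnd, hx]
  have hrev := hw.reverseDarts
  rw [hend] at hrev
  -- The inverse transformation must send the base vertex to the end point of the lift of the
  -- reversed word of `x`.
  let y : CoverVertex G o := follow coverBase (reverseDarts x.1)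
  have hy : coverProj y = o := (coverProj_follow (c := coverBase) hrev.1).trans hrev.2
  have hxy : follow x y.1 = coverBase := by
    have h1 : follow x y.1 = follow x (reverseDarts x.1) := follow_follow hx hrev.1
    rw [h1]
    have h2 := follow_reverseDarts (c := (coverBase : CoverVertex G o)) hw
    rwa [follow_coverBase] at h2
  have hyx : follow y x.1 = coverBase := by
    have h2 := follow_reverseDarts (c := (coverBase : CoverVertex G o)) hrev.1
    rwa [reverseDarts_reverseDarts] at h2
  refine ⟨⟨⟨fun c => follow x c.1, fun c => follow y c.1, fun c => follow_inverse hy hyx c hx,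
    fun c => follow_inverse hx hxy c hy⟩, fun {c d} => ⟨fun h => ?_, adj_follow hx⟩⟩,
    fun c => ?_, fun c => rfl⟩
  · have h1 := adj_follow hy h
    change (cover G o).Adj (follow y (follow x c.1).1) (follow y (follow x d.1).1) at h1
    rwa [follow_inverse hy hyx c hx, follow_inverse hy hyx d hx] at h1
  · show coverProj (follow x c.1) = _
    rw [coverProj_follow (hx.symm ▸ isWalkFrom_cover c), hx, coverProj_eq_walkEnd]

/-- Walking the word of `c` backwards from `d` leads to the vertex to which the base vertex must
move. The transformation sending it there then sends `c` to `d`. -/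
theorem exists_deck {c d : CoverVertex G o} (h : coverProj c = coverProj d) :
    ∃ γ ∈ deckGroup G o, γ c = d := by
  have hrev := (isWalkFrom_cover c).reverseDarts
  rw [← coverProj_eq_walkEnd, h] at hrev
  obtain ⟨γ, hγ, hγc⟩ := exists_deck_base (x := follow d (reverseDarts c.1))
    ((coverProj_follow hrev.1).trans hrev.2)
  refine ⟨γ, hγ, ?_⟩
  have h1 := follow_reverseDarts hrev.1
  rwa [reverseDarts_reverseDarts, ← hγc] at h1

/-- The image edge has the same projected end points, and in a simple graph these determine the
oriented edge. -/
theorem deck_step {γ : cover G o ≃g cover G o} (hγ : γ ∈ deckGroup G o) {c : CoverVertex G o}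
    {e : G.Dart} (he : e.fst = coverProj c) : γ (step c e) = step (γ c) e := by
  have hadj : (cover G o).Adj (γ c) (γ (step c e)) :=
    γ.map_rel_iff.2 (adj_iff_exists_step.2 ⟨e, he, rfl⟩)
  obtain ⟨e', he', h⟩ := adj_iff_exists_step.1 hadj
  obtain rfl : e' = e := by
    refine dart_ext ?_ ?_
    · rw [he', hγ c, he]
    · rw [← coverProj_step he', ← h, hγ (step c e), coverProj_step he]
  exact h

end Deck

/-! ### Lifting functions to the universal cover -/

section LiftFunctions

variable {V : Type*} [Fintype V] {G : SimpleGraph V} [DecidableRel G.Adj] {o : V}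

theorem neighborSum_comp_coverProj (φ : V → ℂ) (c : CoverVertex G o) :
    neighborSum (cover G o) (φ ∘ coverProj) c = neighborSum G φ (coverProj c) := by
  refine Finset.sum_bij (fun d _ => coverProj d) ?_ ?_ ?_ fun _ _ => rfl
  · intro d hd
    obtain ⟨e, he, rfl⟩ := adj_iff_exists_step.1 ((SimpleGraph.mem_neighborFinset _ _ _).1 hd)
    rw [SimpleGraph.mem_neighborFinset, coverProj_step he, ← he]
    exact e.adj
  · intro d hd d' hd' h
    obtain ⟨e, he, rfl⟩ := adj_iff_exists_step.1 ((SimpleGraph.mem_neighborFinset _ _ _).1 hd)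
    obtain ⟨e', he', rfl⟩ := adj_iff_exists_step.1 ((SimpleGraph.mem_neighborFinset _ _ _).1 hd')
    rw [coverProj_step he, coverProj_step he'] at h
    rw [dart_ext (he.trans he'.symm) h]
  · intro y hy
    let e : G.Dart := ⟨(coverProj c, y), (SimpleGraph.mem_neighborFinset _ _ _).1 hy⟩
    exact ⟨step c e, (SimpleGraph.mem_neighborFinset _ _ _).2 (adj_iff_exists_step.2 ⟨e, rfl, rfl⟩),
      coverProj_step rfl⟩

theorem degree_cover (c : CoverVertex G o) : (cover G o).degree c = G.degree (coverProj c) := by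
  -- The neighbor sum of the constant function 1 is the degree.
  have h := neighborSum_comp_coverProj (fun _ => (1 : ℂ)) c
  have h1 : ∑ y ∈ (cover G o).neighborFinset c, (1 : ℂ) =
    ∑ y ∈ G.neighborFinset (coverProj c), (1 : ℂ) := h
  simp only [Finset.sum_const, SimpleGraph.card_neighborFinset_eq_degree, nsmul_eq_mul,
    mul_one] at h1
  exact_mod_cast h1

theorem rescale_comp_coverProj (z : ℂ) (φ : V → ℂ) (c : CoverVertex G o) :
    rescale (cover G o) z (φ ∘ coverProj) c = rescale G z φ (coverProj c) := by
  show (z + (((cover G o).degree c : ℂ) - 1) * z⁻¹) * φ (coverProj c) = _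
  rw [degree_cover]
  rfl

theorem comp_coverProj_mem {z : ℂ} {φ : V → ℂ}
    (h : φ ∈ LinearMap.eqLocus (neighborSum G) (rescale G z)) :
    φ ∘ coverProj ∈ LinearMap.eqLocus (neighborSum (cover G o)) (rescale (cover G o) z) ⊓
      invariantFunctions (deckGroup G o) := by
  refine ⟨?_, fun γ hγ x => ?_⟩
  · refine funext fun c => ?_
    rw [neighborSum_comp_coverProj, rescale_comp_coverProj, LinearMap.mem_eqLocus.1 h]
  · exact congrArg φ ((deckGroup G o).inv_mem hγ x)

/-- Transitivity on the fibers makes an invariant function constant on each fiber, so any section of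
the projection gives the descended function. -/
theorem exists_eq_comp_coverProj (hconn : G.Connected) {z : ℂ} {ψ : CoverVertex G o → ℂ}
    (h : ψ ∈ LinearMap.eqLocus (neighborSum (cover G o)) (rescale (cover G o) z) ⊓
      invariantFunctions (deckGroup G o)) :
    ∃ φ ∈ LinearMap.eqLocus (neighborSum G) (rescale G z), φ ∘ coverProj = ψ := by
  choose s hs using coverProj_surjective (o := o) hconn
  have hψ : (ψ ∘ s) ∘ coverProj = ψ := by
    funext c
    obtain ⟨γ, hγ, hγc⟩ := exists_deck (hs (coverProj c))
    have h1 := h.2 γ⁻¹ ((deckGroup G o).inv_mem hγ) (s (coverProj c))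
    rw [inv_inv, hγc] at h1
    exact h1.symm
  refine ⟨ψ ∘ s, ?_, hψ⟩
  refine funext fun x => ?_
  rw [← hs x, ← neighborSum_comp_coverProj, ← rescale_comp_coverProj, hψ,
    LinearMap.mem_eqLocus.1 h.1]

variable (G o) in
/-- Lifting functions to the universal cover. -/
noncomputable def liftEquiv (hconn : G.Connected) (z : ℂ) :
    LinearMap.eqLocus (neighborSum G) (rescale G z) ≃ₗ[ℂ]
      ↥(LinearMap.eqLocus (neighborSum (cover G o)) (rescale (cover G o) z) ⊓
        invariantFunctions (deckGroup G o)) :=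
  LinearEquiv.ofBijective
    ((LinearMap.funLeft ℂ ℂ (coverProj : CoverVertex G o → V)).restrict
      fun _ => comp_coverProj_mem) (by
    constructor
    · intro φ φ' h
      refine Subtype.ext (funext fun x => ?_)
      obtain ⟨c, rfl⟩ := coverProj_surjective (o := o) hconn x
      exact congrFun (congrArg Subtype.val h) c
    · intro ψ
      obtain ⟨φ, hφ, h⟩ := exists_eq_comp_coverProj hconn ψ.2
      exact ⟨⟨φ, hφ⟩, Subtype.ext h⟩)

end LiftFunctions

/-! ### Distances in the universal cover -/

section Distances

variable {V : Type*} {G : SimpleGraph V} {o : V}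

/-- The branch of extensions of `y` is joined to the rest of the tree only by the edge from `y` to
`x`. -/
theorem dist_of_not_prefix {x y w : CoverVertex G o} {e : G.Dart} (h : y.1 = x.1 ++ [e])
    (hw : ¬ y.1 <+: w.1) : (cover G o).dist y w = (cover G o).dist x w + 1 := by
  classical
  have hconn := (cover_isTree G o).connected
  have hadj : (cover G o).Adj y x := Or.inr ⟨e, h⟩
  apply le_antisymm
  · have h1 := hconn.dist_triangle (u := y) (v := x) (w := w)
    rw [SimpleGraph.dist_eq_one_iff_adj.2 hadj] at h1
    omega
  · obtain ⟨p, hp⟩ := hconn.exists_walk_length_eq_dist y w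
    -- A shortest walk from `y` to `w` leaves the branch somewhere; the edge used must end at `x`,
    -- so `x` lies on the walk.
    obtain ⟨d, hd, hd1, hd2⟩ := p.exists_boundary_dart {v | y.1 <+: v.1} (List.prefix_refl _) hw
    have hx : d.snd = x := by
      rcases d.adj with ⟨e', he'⟩ | ⟨e', he'⟩
      · exact (hd2 (List.IsPrefix.trans hd1 ⟨[e'], he'.symm⟩)).elim
      · have hd1' : y.1 <+: d.fst.1 := hd1
        rw [he', List.prefix_concat_iff] at hd1'
        rcases hd1' with h1 | h1
        · rw [h] at h1
          exact Subtype.ext (List.append_inj_left' h1 rfl).symm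
        · exact (hd2 h1).elim
    have hxp : x ∈ p.support := hx ▸ p.dart_snd_mem_support_of_mem_darts hd
    have hlen := congrArg SimpleGraph.Walk.length (p.take_spec hxp)
    rw [SimpleGraph.Walk.length_append] at hlen
    have h1 := SimpleGraph.dist_le (p.dropUntil x hxp)
    have h2 := SimpleGraph.dist_le (p.takeUntil x hxp)
    rw [SimpleGraph.dist_eq_one_iff_adj.2 hadj] at h2
    omega

theorem dist_coverBase (c : CoverVertex G o) : (cover G o).dist coverBase c = c.1.length := by
  have h : ∀ w : List G.Dart, ∀ c : CoverVertex G o, c.1 = w →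
      (cover G o).dist coverBase c = w.length := by
    intro w
    induction w using List.reverseRecOn with
    | nil =>
      intro c hc
      obtain rfl : c = coverBase := Subtype.ext hc
      simp
    | append_singleton w e ih =>
      intro c hc
      obtain ⟨d, hd⟩ := exists_eq_concat (c := c) (e := e) (by rw [hc]; simp)
      have hdw : d.1 = w := List.append_cancel_right (hd.symm.trans hc)
      rw [SimpleGraph.dist_comm, dist_of_not_prefix hd (by simp [hc, coverBase]),
        SimpleGraph.dist_comm, ih d hdw, List.length_append, List.length_singleton]
  exact h c.1 c rfl

/-- The oriented edge from a vertex of the universal cover to an extension of it. -/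
def outDart {c d : CoverVertex G o} {e : G.Dart} (h : d.1 = c.1 ++ [e]) : (cover G o).Dart :=
  ⟨(c, d), Or.inl ⟨e, h⟩⟩

theorem pointsAway_outDart {c d b : CoverVertex G o} {e : G.Dart} (h : d.1 = c.1 ++ [e])
    (hb : b.1.length ≤ c.1.length) : PointsAway (outDart h) b := by
  show (cover G o).dist b d = (cover G o).dist b c + 1
  rw [SimpleGraph.dist_comm, dist_of_not_prefix h, SimpleGraph.dist_comm]
  intro hp
  have h1 := hp.length_le
  rw [h, List.length_append, List.length_singleton] at h1
  omega

theorem eq_concat_of_pointsAway {c d : CoverVertex G o} (hadj : (cover G o).Adj c d)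
    (h : (cover G o).dist coverBase d = (cover G o).dist coverBase c + 1) :
    ∃ e, d.1 = c.1 ++ [e] := by
  rw [dist_coverBase, dist_coverBase] at h
  rcases hadj with h1 | ⟨e, h1⟩
  · exact h1
  · rw [h1, List.length_append, List.length_singleton] at h
    omega

theorem dist_iso {W : Type*} {T : SimpleGraph W} (hT : T.Connected) (γ : T ≃g T) (x y : W) :
    T.dist (γ x) (γ y) = T.dist x y := by
  have h : ∀ (γ : T ≃g T) (x y : W), T.dist (γ x) (γ y) ≤ T.dist x y := by
    intro γ x y
    obtain ⟨p, hp⟩ := hT.exists_walk_length_eq_dist x y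
    rw [← hp, ← SimpleGraph.Walk.length_map γ.toHom p]
    exact SimpleGraph.dist_le (p.map γ.toHom)
  refine le_antisymm (h γ x y) ?_
  have h1 := h γ.symm (γ x) (γ y)
  rwa [γ.symm_apply_apply, γ.symm_apply_apply] at h1

end Distances

end GraphSpectral

namespace GraphSpectral

/-! ### The boundary of the universal cover as a space of paths -/

section BoundaryPaths

open TopologicalSpace (Clopens)

variable {V : Type*} {G : SimpleGraph V} {o : V}

theorem length_initialSegment (p : island G o) (n : ℕ) :
    (initialSegment p n).1.length = n := by
  simp [initialSegment]

theorem initialSegment_eq_iff {p : island G o} {c : CoverVertex G o} :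
    initialSegment p c.1.length = c ↔ p.1 ∈ district c.1 := by
  rw [mem_district_iff_map_range]
  exact ⟨fun h => congrArg Subtype.val h, fun h => Subtype.ext h⟩

theorem initialSegment_succ (p : island G o) (n : ℕ) :
    (initialSegment p (n + 1)).1 = (initialSegment p n).1 ++ [p.1 n] := by
  simp [initialSegment, List.range_succ]

theorem mem_district_of_prefix_initialSegment {p : island G o} {c : CoverVertex G o} {n : ℕ}
    (h : c.1 <+: (initialSegment p n).1) : p.1 ∈ district c.1 := by
  rw [mem_district]
  intro i hi
  rw [h.getElem hi]
  simp [initialSegment]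

/-- A ray in the universal cover that points away from the base vertex comes from a path that
starts at `o`. -/
theorem exists_liftPath (r : PathSpace (cover G o)) (hr : PointsAway (r 0) coverBase) :
    ∃ p : island G o, ∀ k, initialSegment p ((r 0).fst.1.length + k) = (r k).fst := by
  set m := (r 0).fst.1.length with hm
  have hway := fun k => pointsAway_path (cover_isTree G o) r hr k
  simp only [zero_add, dist_coverBase] at hway
  have hlen : ∀ k, (r k).fst.1.length = m + k := fun k => (hway k).2
  have hsucc : ∀ k, (r k).fst.1 <+: (r (k + 1)).fst.1 := by
    intro k
    have h1 : (r k).snd = (r (k + 1)).fst := (r.2 k).1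
    obtain ⟨e, he⟩ := eq_concat_of_pointsAway (r k).adj (hway k).1
    rw [← h1, he]
    exact List.prefix_append _ _
  have hmono : ∀ j k, j ≤ k → (r j).fst.1 <+: (r k).fst.1 := by
    intro j k hjk
    induction k, hjk using Nat.le_induction with
    | base => exact List.prefix_refl _
    | succ k _ ih => exact ih.trans (hsucc k)
  have hget : ∀ i j k (hj : i < (r j).fst.1.length) (hk : i < (r k).fst.1.length),
      (r j).fst.1[i] = (r k).fst.1[i] := by
    intro i j k hj hk
    rcases le_total j k with h | h
    · exact (hmono j k h).getElem hj
    · exact ((hmono k j h).getElem hk).symm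
  have hlt : ∀ i, i < (r (i + 1)).fst.1.length := fun i => by rw [hlen]; omega
  -- The origins of the edges of `r` form an increasing chain of prefixes. The one with index i + 1
  -- has more than i edges, so its i-th edge exists, and by `hget` any other long enough member
  -- gives the same one.
  let q : ℕ → G.Dart := fun i => (r (i + 1)).fst.1[i]'(hlt i)
  have hq : ∀ i, Turn (q i) (q (i + 1)) := by
    intro i
    have h1 := List.isChain_iff_getElem.1 (r (i + 1 + 1)).fst.2.1 i (hlt (i + 1))
    rwa [hget i (i + 1 + 1) (i + 1) (by have := hlt (i + 1); omega) (hlt i)] at h1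
  have hq0 : (q 0).fst = o := by
    refine (r 1).fst.2.2 _ ?_
    rw [List.head?_eq_getElem?, Option.mem_def, List.getElem?_eq_getElem (hlt 0)]
  refine ⟨⟨⟨q, hq⟩, hq0⟩, fun k => Subtype.ext (List.ext_getElem ?_ fun i h1 h2 => ?_)⟩
  · rw [length_initialSegment, hlen]
  · have h3 : (r (i + 1)).fst.1[i]'(hlt i) = (r k).fst.1[i] := hget _ _ _ _ _
    rw [← h3]
    simp [initialSegment, q]

/-- Dictionary between the two topologies: forward sets of outward edges correspond to districts of
paths from `o`. -/
theorem mem_forwardSet_outDart {c d : CoverVertex G o} {e : G.Dart} (h : d.1 = c.1 ++ [e])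
    {ω : Boundary (cover G o)} : ω ∈ forwardSet (outDart h) ↔
      ∃ p : island G o, p.1 ∈ district d.1 ∧ islandToBoundary p = ω := by
  have hdl : d.1.length = c.1.length + 1 := by rw [h, List.length_append, List.length_singleton]
  constructor
  · rintro ⟨r, hr, rfl⟩
    obtain ⟨p, hp⟩ := exists_liftPath r (by rw [hr]; exact pointsAway_outDart h (by simp [coverBase]))
    refine ⟨p, ?_, ?_⟩
    · rw [← initialSegment_eq_iff, hdl]
      have h1 := hp 1
      have h2 : (r 0).snd = (r 1).fst := (r.2 0).1
      rw [← h2, hr] at h1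
      exact h1
    · refine Quotient.sound ⟨(r 0).fst.1.length, 0, fun k => ?_⟩
      rw [zero_add]
      refine dart_ext (hp k) ?_
      rw [(r.2 k).1, ← hp (k + 1)]
      rfl
  · rintro ⟨p, hp, rfl⟩
    refine ⟨(liftPath p).drop c.1.length, ?_, endOf_drop _ _⟩
    have h1 : initialSegment p d.1.length = d := initialSegment_eq_iff.2 hp
    have h2 : initialSegment p c.1.length = c := by
      rw [initialSegment_eq_iff]
      rw [h, mem_district_concat] at hp
      exact hp.1
    refine dart_ext h2 ?_
    rw [hdl] at h1
    exact h1

theorem islandToBoundary_injective :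
    Function.Injective (islandToBoundary : island G o → Boundary (cover G o)) := by
  intro p q h
  obtain ⟨m, n, hmn⟩ := Quotient.exact h
  have hseg : ∀ k, initialSegment p (m + k) = initialSegment q (n + k) := fun k =>
    congrArg (fun d => d.fst) (hmn k)
  -- The length of an initial segment is its index, so two confluent lifts coincide without a shift.
  obtain rfl : m = n := by
    have h1 := congrArg (fun c => c.1.length) (hseg 0)
    simpa [length_initialSegment] using h1
  refine Subtype.ext (Subtype.ext (funext fun i => ?_))
  have h1 := congrArg Subtype.val (hseg (i + 1))
  have h2 := List.getElem_of_eq h1 (i := i) (by rw [length_initialSegment]; omega)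
  simpa [initialSegment] using h2

theorem islandToBoundary_surjective :
    Function.Surjective (islandToBoundary : island G o → Boundary (cover G o)) := by
  intro ω
  obtain ⟨d, hd, -, hω⟩ := exists_forwardSet (cover_isTree G o) coverBase coverBase ω
  obtain ⟨e, he⟩ := eq_concat_of_pointsAway d.adj hd
  obtain ⟨p, -, hp⟩ := (mem_forwardSet_outDart he).1 hω
  exact ⟨p, hp⟩

theorem isOpenMap_islandToBoundary :
    IsOpenMap (islandToBoundary : island G o → Boundary (cover G o)) := by
  intro U hU
  rw [isOpen_iff_forall_mem_open]
  rintro _ ⟨p, hp, rfl⟩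
  obtain ⟨U', hU', rfl⟩ := isOpen_induced_iff.1 hU
  obtain ⟨n, hn⟩ := exists_agree_subset hU' hp
  -- A forward set belongs to an edge, so agreement is imposed on n + 1 edges; n would not do when n
  -- = 0.
  have h := initialSegment_succ p n
  refine ⟨forwardSet (outDart h), ?_, isOpen_forwardSet _, ?_⟩
  · intro ω hω
    obtain ⟨q, hq, rfl⟩ := (mem_forwardSet_outDart h).1 hω
    refine ⟨q, hn q.1 fun i hi => ?_, rfl⟩
    rw [mem_district.1 hq i (by rw [length_initialSegment]; omega)]
    simp [initialSegment]
  · refine (mem_forwardSet_outDart h).2 ⟨p, ?_, rfl⟩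
    rw [← initialSegment_eq_iff, length_initialSegment]

variable (G o) in
/-- The homeomorphism of the island of `o` with the boundary of the universal cover. -/
noncomputable def islandHomeomorph : island G o ≃ₜ Boundary (cover G o) :=
  (Equiv.ofBijective islandToBoundary
    ⟨islandToBoundary_injective, islandToBoundary_surjective⟩).toHomeomorphOfContinuousOpen
      islandToBoundary.continuous isOpenMap_islandToBoundary

theorem symm_islandToBoundary (p : island G o) :
    (islandHomeomorph G o).symm (islandToBoundary p) = p :=
  (islandHomeomorph G o).symm_apply_apply p

variable (G o) in
/-- The path that starts at `o` and whose lift tends to a given end. -/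
noncomputable def boundaryToPath : C(Boundary (cover G o), PathSpace G) where
  toFun ω := ((islandHomeomorph G o).symm ω).1
  continuous_toFun := continuous_subtype_val.comp (islandHomeomorph G o).symm.continuous

theorem boundaryToPath_islandToBoundary (p : island G o) :
    boundaryToPath G o (islandToBoundary p) = p.1 :=
  congrArg Subtype.val (symm_islandToBoundary p)

theorem boundaryToPath_mem_island (ω : Boundary (cover G o)) :
    boundaryToPath G o ω ∈ island G o :=
  ((islandHomeomorph G o).symm ω).2

variable (G o) in
/-- Extension by zero of measures on the boundary to measures on the path space. -/
noncomputable def extension : FAMeasure (Boundary (cover G o)) →ₗ[ℂ] FAMeasure (PathSpace G) :=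
  pushforward (boundaryToPath G o)

/-- The set of ends of the rays from the base vertex through `d`. -/
noncomputable def cylinder (d : CoverVertex G o) : Clopens (Boundary (cover G o)) :=
  ⟨boundaryToPath G o ⁻¹' (district d.1),
    (district d.1).isClopen.preimage (boundaryToPath G o).continuous⟩

theorem extension_district (ν : FAMeasure (Boundary (cover G o))) (d : CoverVertex G o) :
    extension G o ν (district d.1) = ν (cylinder d) := rfl

theorem islandToBoundary_mem_cylinder {p : island G o} {d : CoverVertex G o} :
    islandToBoundary p ∈ cylinder d ↔ p.1 ∈ district d.1 := by
  show boundaryToPath G o (islandToBoundary p) ∈ district d.1 ↔ _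
  rw [boundaryToPath_islandToBoundary]

theorem mem_cylinder_iff {c d : CoverVertex G o} {e : G.Dart} (h : d.1 = c.1 ++ [e])
    {ω : Boundary (cover G o)} : ω ∈ cylinder d ↔ ω ∈ forwardSet (outDart h) := by
  obtain ⟨p, rfl⟩ := islandToBoundary_surjective ω
  rw [islandToBoundary_mem_cylinder, mem_forwardSet_outDart]
  constructor
  · exact fun hp => ⟨p, hp, rfl⟩
  · rintro ⟨q, hq, hqp⟩
    rwa [← islandToBoundary_injective hqp]

/-- Extension by zero is a section of the restriction, so uniqueness results for measures on paths
carry over to the boundary. -/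
theorem restriction_extension (ν : FAMeasure (Boundary (cover G o))) :
    restriction G o (extension G o ν) = ν := by
  refine Subtype.ext (funext fun A => ?_)
  refine congrArg ν.1 (SetLike.ext fun ω => ?_)
  obtain ⟨p, rfl⟩ := islandToBoundary_surjective ω
  show boundaryToPath G o (islandToBoundary p) ∈
    Subtype.val '' ((islandToBoundary : C(island G o, Boundary (cover G o))) ⁻¹' A) ↔ _
  rw [boundaryToPath_islandToBoundary, Subtype.val_injective.mem_set_image]
  rfl

/-- The empty word must be excluded: its district is the whole path space, while its cylinder
corresponds only to the paths from `o`. -/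
theorem restriction_cylinder (μ : FAMeasure (PathSpace G)) {d : CoverVertex G o}
    (hd : d.1 ≠ []) : restriction G o μ (cylinder d) = μ (district d.1) := by
  refine congrArg μ.1 (SetLike.ext fun p => ?_)
  show p ∈
    Subtype.val '' ((islandToBoundary : C(island G o, Boundary (cover G o))) ⁻¹' cylinder d) ↔ _
  constructor
  · rintro ⟨q, hq, rfl⟩
    exact islandToBoundary_mem_cylinder.1 hq
  · intro hp
    have hpo : p ∈ island G o := by
      obtain ⟨e, l, hel⟩ := List.exists_cons_of_ne_nil hd
      have h1 := hp
      rw [hel, mem_district_cons] at h1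
      show (p 0).fst = o
      rw [h1.1]
      exact d.2.2 e (by rw [hel]; rfl)
    exact ⟨⟨p, hpo⟩, islandToBoundary_mem_cylinder.2 hp, rfl⟩

theorem extension_district_cons_eq_zero (ν : FAMeasure (Boundary (cover G o))) {e : G.Dart}
    (he : e.fst ≠ o) (w : List G.Dart) : extension G o ν (district (e :: w)) = 0 := by
  rw [← measure_bot ν]
  refine congrArg ν.1 (le_bot_iff.1 fun ω hω => (he ?_).elim)
  have h1 : boundaryToPath G o ω 0 = e := (mem_district_cons.1 hω).1
  rw [← h1]
  exact boundaryToPath_mem_island ω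

/-- A measure on the boundary is determined by its values on small cylinders. -/
theorem measure_ext_of_cylinder [Finite G.Dart] {μ ν : FAMeasure (Boundary (cover G o))} (M : ℕ)
    (h : ∀ d : CoverVertex G o, M ≤ d.1.length → μ (cylinder d) = ν (cylinder d)) : μ = ν := by
  rw [← restriction_extension μ, ← restriction_extension ν]
  congr 1
  refine measure_ext_of_district M fun w hM hw => ?_
  cases w with
  | nil => exact h coverBase hM
  | cons e w =>
    by_cases he : e.fst = o
    · exact h ⟨e :: w, hw, by simpa using he⟩ hM
    · rw [extension_district_cons_eq_zero μ he, extension_district_cons_eq_zero ν he]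

theorem measure_cylinder_eq_sum [Fintype G.Dart] (ν : FAMeasure (Boundary (cover G o)))
    (c : CoverVertex G o) :
    ν (cylinder c) = ∑ e : G.Dart, extension G o ν (district (c.1 ++ [e])) := by
  rw [← extension_district, measure_district_eq_sum]

/-! ### The twisted action on cylinders -/

theorem mem_forwardSet_boundaryMap {W : Type*} {T : SimpleGraph W} (γ : T ≃g T) {e e' : T.Dart}
    (h1 : γ e.fst = e'.fst) (h2 : γ e.snd = e'.snd) {ω : Boundary T} :
    boundaryMap γ ω ∈ forwardSet e' ↔ ω ∈ forwardSet e := by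
  obtain ⟨p, rfl⟩ : ∃ p, endOf p = ω := Quotient.exists_rep ω
  constructor
  · rintro ⟨q, hq, hqp⟩
    refine ⟨rayMap γ.symm q, ?_, ?_⟩
    · show γ.symm.toHom.mapDart (q 0) = e
      rw [hq]
      refine dart_ext ?_ ?_
      · show γ.symm e'.fst = e.fst
        rw [← h1, γ.symm_apply_apply]
      · show γ.symm e'.snd = e.snd
        rw [← h2, γ.symm_apply_apply]
    · rw [rayMap_confluent γ.symm (show endOf q = endOf (rayMap γ p) from hqp), rayMap_symm]
  · rintro ⟨q, hq, hqp⟩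
    refine ⟨rayMap γ q, ?_, rayMap_confluent γ hqp⟩
    show γ.toHom.mapDart (q 0) = e'
    rw [hq]
    exact dart_ext h1 h2

/-- The edge from `c'` to `d'` points away from both the base vertex and its image under γ. So the
twist is constant on the cylinder, with exponent d(γõ, γc) − d(õ, c') = |c| − |c'|. -/
theorem twistedAction_cylinder {γ : cover G o ≃g cover G o} {c d c' d' : CoverVertex G o}
    {e e' : G.Dart} (h : d.1 = c.1 ++ [e]) (h' : d'.1 = c'.1 ++ [e']) (hc : γ c = c')
    (hd : γ d = d') (z : ℂ) (ν : FAMeasure (Boundary (cover G o))) :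
    twistedAction (cover_isTree G o) coverBase z γ ν (cylinder d') =
      z ^ ((c.1.length : ℤ) - c'.1.length) * ν (cylinder d) := by
  have hT := cover_isTree G o
  have hdist : ∀ x, (cover G o).dist (γ coverBase) (γ x) = x.1.length := fun x => by
    rw [dist_iso hT.connected, dist_coverBase]
  have hfun : charFn (cylinder d') * kernel hT z (γ coverBase) coverBase =
      z ^ ((c.1.length : ℤ) - c'.1.length) • charFn (cylinder d') := by
    refine LocallyConstant.ext fun ω => ?_
    show charFn (cylinder d') ω * z ^ horoDist ω (γ coverBase) coverBase =
      z ^ ((c.1.length : ℤ) - c'.1.length) * charFn (cylinder d') ω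
    by_cases hω : ω ∈ cylinder d'
    · rw [horoDist_eq hT (e := outDart h') ?_ (pointsAway_outDart h' (by simp [coverBase]))
        ((mem_cylinder_iff h').1 hω)]
      · show _ * z ^ (((cover G o).dist (γ coverBase) c' : ℤ) - (cover G o).dist coverBase c') = _
        rw [← hc, hdist, dist_coverBase, mul_comm]
      · show (cover G o).dist (γ coverBase) d' = (cover G o).dist (γ coverBase) c' + 1
        rw [← hc, ← hd, hdist, hdist, h, List.length_append, List.length_singleton]
    · rw [charFn_apply_of_notMem hω, zero_mul, mul_zero]
  show integral (pushforward (boundaryMap γ) ν) (charFn (cylinder d') * kernel hT z _ _) = _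
  rw [hfun, integral_smul _ _ _ (charFn_range _), integral_charFn]
  congr 1
  refine congrArg ν.1 (SetLike.ext fun ω => ?_)
  show boundaryMap γ ω ∈ cylinder d' ↔ _
  rw [mem_cylinder_iff h, mem_cylinder_iff h']
  exact mem_forwardSet_boundaryMap γ hc hd

end BoundaryPaths

end GraphSpectral

namespace GraphSpectral

section Correspondence

variable {V : Type*} {G : SimpleGraph V} {o : V}

/-! ### Restricting eigenmeasures to the boundary -/

theorem mem_twistedInvariants {z : ℂ} {ν : FAMeasure (Boundary (cover G o))} :
    ν ∈ twistedInvariants (cover_isTree G o) coverBase z (deckGroup G o) ↔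
      ∀ γ ∈ deckGroup G o, twistedAction (cover_isTree G o) coverBase z γ ν = ν := by
  simp [twistedInvariants, Submodule.mem_iInf, LinearMap.mem_eqLocus]

/-- A deck transformation taking `c` to `c'` takes the lift of `e` at `c` to the lift at `c'`, and
the twist is exactly the ratio of the two normalizing powers. -/
theorem pow_mul_cylinder_eq {z : ℂ} (hz : z ≠ 0) {ν : FAMeasure (Boundary (cover G o))}
    (hν : ν ∈ twistedInvariants (cover_isTree G o) coverBase z (deckGroup G o))
    {c d c' d' : CoverVertex G o} {e : G.Dart} (h : d.1 = c.1 ++ [e]) (h' : d'.1 = c'.1 ++ [e]) :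
    z ^ c.1.length * ν (cylinder d) = z ^ c'.1.length * ν (cylinder d') := by
  have he := fst_of_eq_concat h
  have he' := fst_of_eq_concat h'
  obtain ⟨γ, hγ, hγc⟩ := exists_deck (he.symm.trans he')
  have hγd : γ d = d' := by
    rw [eq_step (Or.inl h), deck_step hγ he, hγc, ← eq_step (Or.inl h')]
  have h1 := twistedAction_cylinder h h' hγc hγd z ν
  rw [mem_twistedInvariants.1 hν γ hγ] at h1
  rw [h1, ← mul_assoc, ← zpow_natCast, ← zpow_natCast, ← zpow_add₀ hz]
  congr 2
  ring

variable [Fintype V] [DecidableEq V] [DecidableRel G.Adj]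

theorem restriction_cylinder_eigenmeasure {z : ℂ} (hz : z ≠ 0) {μ : FAMeasure (PathSpace G)}
    (hμ : μ ∈ Module.End.eigenspace (dualTransfer G) z) {c d : CoverVertex G o} {e : G.Dart}
    (h : d.1 = c.1 ++ [e]) :
    restriction G o μ (cylinder d) = z ^ (-(c.1.length : ℤ)) * edgeMass μ e.symm := by
  rw [restriction_cylinder μ (by simp [h]), h, eigenmeasure_district hz hμ _ _ (h ▸ d.2.1)]

theorem restriction_mem {z : ℂ} (hz : z ≠ 0) {μ : FAMeasure (PathSpace G)}
    (hμ : μ ∈ Module.End.eigenspace (dualTransfer G) z) :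
    restriction G o μ ∈ twistedInvariants (cover_isTree G o) coverBase z (deckGroup G o) := by
  refine mem_twistedInvariants.2 fun γ hγ => ?_
  have hγ' := (deckGroup G o).inv_mem hγ
  -- Cylinders this deep lie beyond edges that point away from γõ as well as from õ; hence the
  -- preimage under γ of such an edge is again outward.
  refine measure_ext_of_cylinder ((γ coverBase).1.length + 1) fun d' hd' => ?_
  obtain ⟨c', h'⟩ := exists_eq_concat (c := d') (List.getLast?_eq_some_getLast
    (List.ne_nil_of_length_pos (by omega)))
  set e := d'.1.getLast _
  have hlen : d'.1.length = c'.1.length + 1 := by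
    rw [h', List.length_append, List.length_singleton]
  obtain ⟨c, rfl⟩ : ∃ c, γ c = c' := γ.surjective c'
  obtain ⟨d, rfl⟩ : ∃ d, γ d = d' := γ.surjective d'
  have hadj : (cover G o).Adj c d := γ.map_rel_iff.1 (Or.inl ⟨e, h'⟩)
  have haway := pointsAway_outDart (b := γ coverBase) h' (by omega)
  change (cover G o).dist (γ coverBase) (γ d) = (cover G o).dist (γ coverBase) (γ c) + 1 at haway
  rw [dist_iso (cover_isTree G o).connected, dist_iso (cover_isTree G o).connected] at haway
  obtain ⟨e₁, h⟩ := eq_concat_of_pointsAway hadj haway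
  obtain rfl : e₁ = e := by
    refine dart_ext ?_ ?_
    · rw [fst_of_eq_concat h, fst_of_eq_concat h', hγ c]
    · rw [← coverProj_of_eq_concat h, ← coverProj_of_eq_concat h', hγ d]
  rw [twistedAction_cylinder h h' rfl rfl, restriction_cylinder_eigenmeasure hz hμ h,
    restriction_cylinder_eigenmeasure hz hμ h', ← mul_assoc, ← zpow_add₀ hz]
  congr 2
  ring

/-- The normalized cylinder masses of ν form an edge function. Additivity of ν over one-edge
extensions makes it an eigenfunction of S, and the eigenmeasure built from it has the same cylinder
masses as ν. -/
theorem exists_eigenmeasure_restriction {z : ℂ} (hz : z ≠ 0) (hconn : G.Connected)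
    (hdeg : ∀ v, 2 ≤ G.degree v) {ν : FAMeasure (Boundary (cover G o))}
    (hν : ν ∈ twistedInvariants (cover_isTree G o) coverBase z (deckGroup G o)) :
    ∃ μ ∈ Module.End.eigenspace (dualTransfer G) z, restriction G o μ = ν := by
  choose c d hcd using exists_cover_concat hconn hdeg o
  let f : G.Dart → ℂ := fun e => z ^ (c e.symm).1.length * ν (cylinder (d e.symm))
  have hf : ∀ {c d : CoverVertex G o} {e : G.Dart}, d.1 = c.1 ++ [e] →
      z ^ c.1.length * ν (cylinder d) = f e.symm := by
    intro c' d' e h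
    simp only [f]
    rw [SimpleGraph.Dart.symm_symm]
    exact pow_mul_cylinder_eq hz hν h (hcd e)
  have hfS : f ∈ Module.End.eigenspace (turnSum G) z := by
    rw [Module.End.mem_eigenspace_iff]
    ext e
    have hd := hcd e.symm
    set c₀ := c e.symm
    set d₀ := d e.symm
    have hlen : d₀.1.length = c₀.1.length + 1 := by
      rw [hd, List.length_append, List.length_singleton]
    have h1 : z * f e = z ^ d₀.1.length * ν (cylinder d₀) := by
      rw [hlen, pow_succ']
      show z * (z ^ c₀.1.length * ν (cylinder d₀)) = _
      ring
    -- The sum over extensions runs over all edges; those that do not make a turn contribute empty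
    -- districts.
    have h2 : ∀ e' : G.Dart, z ^ d₀.1.length * extension G o ν (district (d₀.1 ++ [e'])) =
        if Turn e.symm e' then f e'.symm else 0 := by
      intro e'
      have hchain : (d₀.1 ++ [e']).IsChain Turn ↔ Turn e.symm e' := by
        rw [List.isChain_append]
        constructor
        · exact fun h => h.2.2 e.symm (by simp [hd]) e' rfl
        · refine fun h => ⟨d₀.2.1, List.isChain_singleton _, fun x hx y hy => ?_⟩
          obtain rfl : e' = y := by simpa using hy
          obtain rfl : e.symm = x := by simpa [hd] using hx
          exact h
      split_ifs with ht
      · obtain ⟨d₁, hd₁⟩ := exists_concat (c := d₀) (e := e')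
          (by rw [coverProj_of_eq_concat hd]; exact ht.1.symm)
          (by rw [hd]; simpa using ht.2)
        rw [← hf hd₁, ← hd₁, extension_district]
      · rw [district_eq_bot (mt hchain.1 ht), measure_bot, mul_zero]
    show turnSum G f e = z * f e
    rw [h1, measure_cylinder_eq_sum, Finset.mul_sum, Finset.sum_congr rfl fun e' _ => h2 e',
      ← Finset.sum_filter]
    refine Finset.sum_nbij' SimpleGraph.Dart.symm SimpleGraph.Dart.symm ?_ ?_ ?_ ?_ ?_
    · intro e' he'
      exact Finset.mem_filter.2 ⟨Finset.mem_univ _, turn_symm_iff.2 (Finset.mem_filter.1 he').2⟩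
    · intro e' he'
      refine Finset.mem_filter.2 ⟨Finset.mem_univ _, turn_symm_iff.1 ?_⟩
      rw [SimpleGraph.Dart.symm_symm]
      exact (Finset.mem_filter.1 he').2
    · intro _ _; simp
    · intro _ _; simp
    · intro _ _; simp
  obtain ⟨μ, hμ, hμf⟩ := exists_eigenmeasure hz hdeg hfS
  refine ⟨μ, hμ, measure_ext_of_cylinder 1 fun d' hd' => ?_⟩
  obtain ⟨c', h'⟩ := exists_eq_concat (c := d') (List.getLast?_eq_some_getLast
    (List.ne_nil_of_length_pos hd'))
  rw [restriction_cylinder_eigenmeasure hz hμ h', hμf, ← hf h', ← mul_assoc, ← zpow_natCast,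
    ← zpow_add₀ hz, neg_add_cancel, zpow_zero, one_mul]

/-- Every edge is the last edge of some path from `o`, so the restriction still sees all edge
masses. -/
theorem restriction_injOn {z : ℂ} (hz : z ≠ 0) (hconn : G.Connected)
    (hdeg : ∀ v, 2 ≤ G.degree v) {μ μ' : FAMeasure (PathSpace G)}
    (hμ : μ ∈ Module.End.eigenspace (dualTransfer G) z)
    (hμ' : μ' ∈ Module.End.eigenspace (dualTransfer G) z)
    (h : restriction G o μ = restriction G o μ') : μ = μ' := by
  refine edgeMass_injOn hz hμ hμ' (funext fun e => ?_)
  obtain ⟨c, d, hcd⟩ := exists_cover_concat hconn hdeg o e.symm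
  have h1 := restriction_cylinder_eigenmeasure hz hμ hcd
  rw [h, restriction_cylinder_eigenmeasure hz hμ' hcd, SimpleGraph.Dart.symm_symm] at h1
  exact (mul_left_cancel₀ (zpow_ne_zero _ hz) h1).symm

variable (G o) in
/-- Restriction identifies the eigenmeasures of the dual transfer operator with the twisted
invariant measures on the boundary of the universal cover. -/
noncomputable def restrictionEquiv {z : ℂ} (hz : z ≠ 0) (hconn : G.Connected)
    (hdeg : ∀ v, 2 ≤ G.degree v) :
    Module.End.eigenspace (dualTransfer G) z ≃ₗ[ℂ]
      twistedInvariants (cover_isTree G o) coverBase z (deckGroup G o) :=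
  LinearEquiv.ofBijective ((restriction G o).restrict fun _ => restriction_mem hz) (by
    constructor
    · intro μ ν h
      exact Subtype.ext (restriction_injOn hz hconn hdeg μ.2 ν.2 (congrArg Subtype.val h))
    · intro ν
      obtain ⟨μ, hμ, h⟩ := exists_eigenmeasure_restriction hz hconn hdeg ν.2
      exact ⟨⟨μ, hμ⟩, Subtype.ext h⟩)

end Correspondence

/-! ### The Poisson transform -/

section Poisson

variable {V : Type*} {G : SimpleGraph V} {o : V}

theorem islandToBoundary_mem_forwardSet (p : island G o) (n : ℕ) :
    islandToBoundary p ∈ forwardSet ((liftPath p) n) :=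
  ⟨(liftPath p).drop n, rfl, endOf_drop _ _⟩

theorem horoDist_of_mem_district {p : island G o} {y : CoverVertex G o}
    (h : p.1 ∈ district y.1) : horoDist (islandToBoundary p) coverBase y = y.1.length := by
  have hT := cover_isTree G o
  have hy : initialSegment p y.1.length = y := initialSegment_eq_iff.2 h
  have hsucc := initialSegment_succ p y.1.length
  have hlen : ((liftPath p) y.1.length).fst = y := hy
  have haway : ∀ b : CoverVertex G o, b.1.length ≤ y.1.length →
      PointsAway ((liftPath p) y.1.length) b := fun b hb =>
    pointsAway_outDart hsucc (by rwa [length_initialSegment])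
  rw [horoDist_eq hT (haway coverBase (by simp [coverBase])) (haway y le_rfl)
    (islandToBoundary_mem_forwardSet p _), hlen, dist_coverBase]
  simp

/-- A ray that avoids `y` never enters the branch beyond it, so all its vertices are one step
further from `y` than from `x`. -/
theorem horoDist_of_notMem_district {p : island G o} {x y : CoverVertex G o} {e : G.Dart}
    (h : y.1 = x.1 ++ [e]) (hp : p.1 ∉ district y.1) :
    horoDist (islandToBoundary p) coverBase y = horoDist (islandToBoundary p) coverBase x - 1 := by
  have hT := cover_isTree G o
  have hmem := islandToBoundary_mem_forwardSet p
  have haway : ∀ n, PointsAway ((liftPath p) n) coverBase := fun n =>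
    pointsAway_outDart (initialSegment_succ p n) (by simp [coverBase])
  obtain ⟨M, hM⟩ := exists_pointsAway hT x (liftPath p)
  obtain ⟨N, hN⟩ := exists_pointsAway hT y (liftPath p)
  have hx := (pointsAway_path hT (liftPath p) hM N).1
  have hy := (pointsAway_path hT (liftPath p) hN M).1
  rw [add_comm] at hy
  have hdist : (cover G o).dist y ((liftPath p) (M + N)).fst =
      (cover G o).dist x ((liftPath p) (M + N)).fst + 1 :=
    dist_of_not_prefix h fun hpre => hp (mem_district_of_prefix_initialSegment hpre)
  rw [horoDist_eq hT (haway _) hy (hmem _), horoDist_eq hT (haway _) hx (hmem _), hdist]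
  push_cast
  ring

/-- Off the cylinder the kernel is divided by z. On it the kernel passes from z^|x| to z^(|x|+1),
and the second term supplies the difference from z^(|x|−1). -/
theorem kernel_concat {x y : CoverVertex G o} {e : G.Dart} (h : y.1 = x.1 ++ [e]) {z : ℂ}
    (hz : z ≠ 0) : kernel (cover_isTree G o) z coverBase y =
      z⁻¹ • kernel (cover_isTree G o) z coverBase x +
        ((z - z⁻¹) * z ^ x.1.length) • charFn (cylinder y) := by
  refine LocallyConstant.ext fun ω => ?_
  obtain ⟨p, rfl⟩ := islandToBoundary_surjective ω
  show z ^ horoDist (islandToBoundary p) coverBase y =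
    z⁻¹ * z ^ horoDist (islandToBoundary p) coverBase x +
      ((z - z⁻¹) * z ^ x.1.length) * charFn (cylinder y) (islandToBoundary p)
  by_cases hp : p.1 ∈ district y.1
  · have hpx : p.1 ∈ district x.1 := by
      rw [h, mem_district_concat] at hp
      exact hp.1
    rw [charFn_apply_of_mem (islandToBoundary_mem_cylinder.2 hp), horoDist_of_mem_district hp,
      horoDist_of_mem_district hpx, h, List.length_append, List.length_singleton, zpow_natCast,
      zpow_natCast, pow_succ]
    ring
  · rw [charFn_apply_of_notMem (mt islandToBoundary_mem_cylinder.1 hp),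
      horoDist_of_notMem_district h hp, zpow_sub_one₀ hz]
    ring

theorem kernel_self (z : ℂ) :
    kernel (cover_isTree G o) z coverBase coverBase = charFn (cylinder coverBase) := by
  refine LocallyConstant.ext fun ω => ?_
  obtain ⟨p, rfl⟩ := islandToBoundary_surjective ω
  have hp : p.1 ∈ district (coverBase : CoverVertex G o).1 := by simp [mem_district, coverBase]
  rw [charFn_apply_of_mem (islandToBoundary_mem_cylinder.2 hp)]
  show z ^ horoDist (islandToBoundary p) coverBase coverBase = 1
  rw [horoDist_of_mem_district hp]
  simp [coverBase]

theorem poisson_concat {x y : CoverVertex G o} {e : G.Dart} (h : y.1 = x.1 ++ [e]) {z : ℂ}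
    (hz : z ≠ 0) (ν : FAMeasure (Boundary (cover G o))) :
    poisson (cover_isTree G o) coverBase z ν y =
      z⁻¹ * poisson (cover_isTree G o) coverBase z ν x +
        (z - z⁻¹) * (z ^ x.1.length * ν (cylinder y)) := by
  show integral ν (kernel _ z coverBase y) = z⁻¹ * integral ν (kernel _ z coverBase x) + _
  have hsmul : ∀ (a : ℂ) (f : LocallyConstant (Boundary (cover G o)) ℂ),
      (Set.range f).Finite → (Set.range (a • f)).Finite := fun a f hf =>
    (hf.image (a * ·)).subset (by rintro _ ⟨ω, rfl⟩; exact ⟨f ω, ⟨ω, rfl⟩, rfl⟩)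
  rw [kernel_concat h hz, integral_add _ _ _ (hsmul _ _ (kernel_range _ _ _ _))
    (hsmul _ _ (charFn_range _)), integral_smul _ _ _ (kernel_range _ _ _ _),
    integral_smul _ _ _ (charFn_range _), integral_charFn]
  ring

variable [Fintype V] [DecidableEq V] [DecidableRel G.Adj]

/-- At the base vertex the kernel is 1, so the transform is the total mass, split here according to
the first edge of the path. -/
theorem poisson_restriction_coverBase {z : ℂ} (μ : FAMeasure (PathSpace G)) :
    poisson (cover_isTree G o) coverBase z (restriction G o μ) coverBase =
      inSum G (edgeMass μ) o := by
  show integral (restriction G o μ) (kernel _ z coverBase coverBase) = _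
  rw [kernel_self, integral_charFn, measure_cylinder_eq_sum]
  have h1 : ∀ e : G.Dart, extension G o (restriction G o μ) (district ([] ++ [e])) =
      if e.fst = o then edgeMass μ e.symm else 0 := by
    intro e
    split_ifs with he
    · obtain ⟨d, hd⟩ := exists_concat (c := (coverBase : CoverVertex G o)) (e := e) he
        (by simp [coverBase])
      have hd' : d.1 = [e] := hd
      rw [List.nil_append, ← hd', extension_district, restriction_cylinder μ (by simp [hd']), hd']
      show _ = μ (district [e.symm.symm])
      rw [SimpleGraph.Dart.symm_symm]
    · exact extension_district_cons_eq_zero _ he []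
  rw [show (coverBase : CoverVertex G o).1 = [] from rfl,
    Finset.sum_congr rfl fun e _ => h1 e, ← Finset.sum_filter]
  refine Finset.sum_nbij' SimpleGraph.Dart.symm SimpleGraph.Dart.symm ?_ ?_ ?_ ?_ ?_
  · intro e he
    simpa using he
  · intro e he
    simpa using he
  · intro _ _; simp
  · intro _ _; simp
  · intro _ _; simp

/-- Induction on the length of the path: with |c| cancelled against the decay of the cylinder
masses, the recursion of `poisson_concat` becomes the relation between the incoming sums at the two
ends of an edge. -/
theorem poisson_restriction {z : ℂ} (hz : z ≠ 0) {μ : FAMeasure (PathSpace G)}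
    (hμ : μ ∈ Module.End.eigenspace (dualTransfer G) z) (c : CoverVertex G o) :
    poisson (cover_isTree G o) coverBase z (restriction G o μ) c =
      inSum G (edgeMass μ) (coverProj c) := by
  have h : ∀ w : List G.Dart, ∀ c : CoverVertex G o, c.1 = w →
      poisson (cover_isTree G o) coverBase z (restriction G o μ) c =
        inSum G (edgeMass μ) (coverProj c) := by
    intro w
    induction w using List.reverseRecOn with
    | nil =>
      intro c hc
      obtain rfl : c = coverBase := Subtype.ext hc
      exact poisson_restriction_coverBase μ
    | append_singleton w e ih =>
      intro y hy
      obtain ⟨x, hx⟩ := exists_eq_concat (c := y) (e := e) (by rw [hy]; simp)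
      have hf := mem_eigenspace_turnSum.1 (edgeMass_mem hμ)
      have h1 := hf e.symm
      rw [SimpleGraph.Dart.symm_symm] at h1
      rw [poisson_concat hx hz, ih x (List.append_cancel_right (hx.symm.trans hy)),
        restriction_cylinder_eigenmeasure hz hμ hx, coverProj_of_eq_concat hx,
        ← fst_of_eq_concat hx, hf e, show e.snd = e.symm.fst from rfl, h1, zpow_neg, zpow_natCast,
        mul_inv_cancel_left₀ (pow_ne_zero _ hz)]
      field_simp
      ring
  exact h c.1 c rfl

end Poisson

end GraphSpectral

/-! ### Assembly of the commutative diagram -/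

open GraphSpectral

theorem mainTheorem4 {V : Type*} [Fintype V] [DecidableEq V] (G : SimpleGraph V)
    [DecidableRel G.Adj] (hconn : G.Connected) (hdeg : ∀ v, 2 ≤ G.degree v) (o : V)
    (z : ℂ) (hz : z ∉ ({-1, 0, 1} : Set ℂ)) :
    ∃ (Φ : Module.End.eigenspace (dualTransfer G) z ≃ₗ[ℂ] Module.End.eigenspace (turnSum G) z)
      (Ψ : Module.End.eigenspace (turnSum G) z ≃ₗ[ℂ]
        LinearMap.eqLocus (neighborSum G) (rescale G z))
      (lift : LinearMap.eqLocus (neighborSum G) (rescale G z) ≃ₗ[ℂ]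
        ↥(LinearMap.eqLocus (neighborSum (cover G o)) (rescale (cover G o) z) ⊓
          invariantFunctions (deckGroup G o)))
      (R : Module.End.eigenspace (dualTransfer G) z ≃ₗ[ℂ]
        twistedInvariants (cover_isTree G o) coverBase z (deckGroup G o))
      (P : twistedInvariants (cover_isTree G o) coverBase z (deckGroup G o) ≃ₗ[ℂ]
        ↥(LinearMap.eqLocus (neighborSum (cover G o)) (rescale (cover G o) z) ⊓
          invariantFunctions (deckGroup G o))),
      -- the five isomorphisms are given by the expected formulas
      (∀ μ, ∀ e : G.Dart, (Φ μ).1 e = μ.1 (district [e.symm])) ∧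
      (∀ f, ∀ (c : List G.Dart) (e : G.Dart), (c ++ [e]).IsChain Turn →
        (Φ.symm f).1 (district (c ++ [e])) = z ^ (-(c.length : ℤ)) * f.1 e.symm) ∧
      (∀ f, (Ψ f).1 = inSum G f.1) ∧
      (∀ φ, (Ψ.symm φ).1 = (z - z⁻¹)⁻¹ • gradient G z φ.1) ∧
      (∀ φ, ∀ x : CoverVertex G o, (lift φ).1 x = φ.1 (coverProj x)) ∧
      (∀ μ, (R μ).1 = restriction G o μ.1) ∧
      (∀ ν, (P ν).1 = poisson (cover_isTree G o) coverBase z ν.1) ∧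
      -- the square commutes
      (∀ μ, P (R μ) = lift (Ψ (Φ μ))) ∧
      -- the equalizers in the diagram are also those of the averaging operators
      LinearMap.eqLocus (neighborSum G) (rescale G z) =
        LinearMap.eqLocus (neighborAvg G) (localTweak G z) ∧
      LinearMap.eqLocus (neighborSum (cover G o)) (rescale (cover G o) z) ⊓
          invariantFunctions (deckGroup G o) =
        LinearMap.eqLocus (neighborAvg (cover G o)) (localTweak (cover G o) z) ⊓
          invariantFunctions (deckGroup G o) := by
  simp only [Set.mem_insert_iff, Set.mem_singleton_iff, not_or] at hz
  obtain ⟨hz1, hz0, hz2⟩ := hz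
  have hz' : z - z⁻¹ ≠ 0 := by
    intro h
    have h1 : z * z = 1 := by
      rw [sub_eq_zero] at h
      nth_rewrite 1 [h]
      exact inv_mul_cancel₀ hz0
    rcases mul_self_eq_one_iff.1 h1 with h2 | h2
    · exact hz2 h2
    · exact hz1 h2
  have hdeg0 : ∀ x, G.degree x ≠ 0 := fun x => by have := hdeg x; omega
  let Φ := edgeMassEquiv G hz0 hdeg
  let Ψ := inSumEquiv G hz0 hz'
  let L := liftEquiv G o hconn z
  let R := restrictionEquiv G o hz0 hconn hdeg
  have hsquare : ∀ μ, (L (Ψ (Φ μ))).1 =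
      poisson (cover_isTree G o) coverBase z (restriction G o μ.1) := fun μ =>
    funext fun c => (poisson_restriction hz0 μ.2 c).symm
  -- The fifth isomorphism is defined as the composite around the square, which makes it bijective
  -- at once; that it is the Poisson transform follows from `hsquare` and surjectivity of `R`.
  refine ⟨Φ, Ψ, L, R, R.symm.trans (Φ.trans (Ψ.trans L)), fun μ e => rfl, fun f c e hc => ?_,
    fun f => rfl, fun φ => rfl, fun φ x => rfl, fun μ => rfl, fun ν => ?_, fun μ => ?_,
    eqLocus_neighborSum_rescale hdeg0 z, ?_⟩
  · have h1 : edgeMass (Φ.symm f).1 = f.1 := congrArg Subtype.val (Φ.apply_symm_apply f)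
    rw [eigenmeasure_district hz0 (Φ.symm f).2 c e hc, h1]
  · obtain ⟨μ, rfl⟩ := R.surjective ν
    simp only [LinearEquiv.trans_apply, LinearEquiv.symm_apply_apply]
    exact hsquare μ
  · simp only [LinearEquiv.trans_apply, LinearEquiv.symm_apply_apply]
  · rw [eqLocus_neighborSum_rescale (G := cover G o) fun c => by
      rw [degree_cover]
      exact hdeg0 _]
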